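/- **Setting.** Let $1\le k<n$ and $\delta\in(0,1)$. There are $n$ arms with means $\mu_1,\dots,\mu_n\in[0,1]$. Each time the player *queries* a set $Q\subseteq[n]$ of at most $k$ arms, a fresh reward vector $X\in\{0,1\}^n$ is drawn, with independent coordinates $X_i\sim\mathrm{Bernoulli}(\mu_i)$, independently of the past and of the player's internal randomness; under *semi-bandit feedback* the player observes $X_i$ for all $i\in Q$. Suppose that the $k$-th largest mean is strictly larger than the $(k+1)$-st, and let $K$ be the set of the $k$ arms with the largest means. Put $V_i=\mu_i(1-\mu_i)$, and let $\Delta_i=\mu_i-\max_{j\notin K}\mu_j$ for $i\in K$ and $\Delta_i=\min_{j\in K}\mu_j-\mu_i$ for $i\notin K$. **Algorithm (Stagewise Elimination).** Start with $U=[n]$, $A=R=\emptyset$. In stages $t=1,2,\dots$, as long as $|A|<k$, do the following. (1) Let $T=2^t$ and $k_1=\min\{|U|,k\}$, and repeat $T$ times, independently: choose uniformly at random a partition of $U$ into $p=\lfloor |U|/k_1\rfloor$ sets $S_1,\dots,S_p$ of size $k_1$ and a remainder $S_0$; query each $S_q$ and record the rewards of its arms; if $S_0\ne\emptyset$, query $S_0\cup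 S_0^+$ with $S_0^+$ a uniformly random subset of $U\setminus S_0$ of size $k_1-|S_0|$, and record the rewards of the arms of $S_0$ only. If every query is required to pull exactly $k$ arms and $k_1<k$, a top-off set $S^+$ is added to these queries, and its rewards are not recorded: $S^+$ is a uniformly random subset of $R$ of size $k-k_1$ if $|R|\ge k-k_1$, and the union of $R$ and a uniformly random subset of $A$ of size $k-k_1-|R|$ otherwise. (2) For $i\in U$ let $\hat\mu_i$ be the average of the $T$ recorded rewards of arm $i$, let $$\hat V_i=\frac{T\hat\mu_i(1-\hat\mu_i)}{T-1},\qquad \hat C_i=\sqrt{\frac{2\hat V_i\log(8nt^2/\delta)}{T}}+\frac{8\log(8nt^2/\delta)}{3(T-1)} ,$$ and let $k_t=k-|A|$. Add to $A$ all $i\in U$ for which $\hat\mu_i-\hat C_i$ is greater than the $(k_t+1)$-st largest of the numbers $\hat\mu_j+\hat C_j$, $j\in U$; add to $R$ all $i\in U$ for which $\hat\mu_i+\hat C_i$ is less than the $k_t$-th largest of the numbers $\hat\mu_j-\hat C_j$, $j\in U$. If $|R|=n-k$ at the beginning of the stage, add all of $U$ to $A$. Then remove the arms of $A\cup R$ from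 $U$. When $|A|\ge k$ the algorithm stops and returns $A$. **Theorem.** Let $$\tau_i=\frac{56}{\Delta_i}+\frac{256}{\Delta_i^2}\begin{cases}\max\{V_i,\max_{j\notin K}V_j\}& i\in K\\ \max\{V_i,\max_{j\in K}V_j\}& i\notin K,\end{cases}\qquad \mathcal T_{n,\delta}(\tau)=\tau\log\Big(\frac{16n\log_2 e}{\delta}\log\Big(\frac{8n\tau\log_2 e}{\delta}\Big)\Big),$$ and let $\sigma$ be a permutation of $[n]$ with $\tau_{\sigma(1)}\ge\dots\ge\tau_{\sigma(n)}$. Whether or not every query is required to pull exactly $k$ arms, Stagewise Elimination with semi-bandit feedback, with probability at least $1-\delta$, stops, returns $K$, and makes at most $$B=8\,\mathcal T_{n,\delta}(\tau_{\sigma(1)})+\frac4k\sum_{i=k+1}^n\mathcal T_{n,\delta}(\tau_{\sigma(i)})$$ queries. Moreover, $$B=\tilde O(Z),\qquad Z=\Big(\tau_{\sigma(1)}+\frac1k\sum_{i=k+1}^n\tau_{\sigma(i)}\Big)\log\frac n\delta,$$ that is, $B\le C\,Z\,(\log Z)^c$ with absolute constants $C,c$. -/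

import Mathlib

namespace BestOfK

noncomputable section

/-! ### The reward distribution and the semi-bandit feedback -/

/-- The product distribution on `{0,1}^n` under which the arms are independent Bernoulli variables
with means `μ i`. -/
def rewardLaw {n : ℕ} (μ : Fin n → unitInterval) : PMF (Fin n → Bool) :=
  PMF.ofFintype
    (fun x => ∏ i, ENNReal.ofReal (if x i = true then (μ i : ℝ) else 1 - (μ i : ℝ))) (by
      classical
      rw [← Fintype.prod_sum
        (fun (i : Fin n) (b : Bool) =>
          ENNReal.ofReal (if b = true then (μ i : ℝ) else 1 - (μ i : ℝ)))]
      refine Finset.prod_eq_one fun i _ => ?_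
      rw [Fintype.sum_bool, if_pos rfl, if_neg (by decide),
        ← ENNReal.ofReal_add (μ i).2.1 (sub_nonneg.2 (μ i).2.2)]
      simp)

/-- Semi-bandit feedback: the player who queries `S` sees the reward of every arm in `S` and
nothing about the other arms. -/
def semiBanditFeedback {n : ℕ} (S : Finset (Fin n)) (x : Fin n → Bool) : Fin n → Option Bool :=
  fun i => if i ∈ S then some (x i) else none

/-! ### The sampling primitives -/

open Classical in
/-- A uniformly random subset of `W` of size `p` (used only for `p ≤ |W|`). -/
def unifSubset {n : ℕ} (W : Finset (Fin n)) (p : ℕ) : PMF (Finset (Fin n)) :=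
  if h : (W.powersetCard p).Nonempty then PMF.uniformOfFinset (W.powersetCard p) h
  else PMF.pure ∅

open Classical in
/-- All sequences of `p` pairwise disjoint subsets of `U`, each of size `m`. -/
def disjointFamilies {n : ℕ} (U : Finset (Fin n)) (p m : ℕ) :
    Finset (Fin p → Finset (Fin n)) :=
  Finset.univ.filter fun S =>
    (∀ q, S q ⊆ U ∧ (S q).card = m) ∧ ∀ q r, q ≠ r → Disjoint (S q) (S r)

open Classical in
/-- Uniformly random choice of `p` pairwise disjoint subsets of `U`, each of size `m` (used only for
`p * m ≤ |U|`); the arms of `U` that are in none of them are the remainder. -/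
def unifPartition {n : ℕ} (U : Finset (Fin n)) (p m : ℕ) : PMF (Fin p → Finset (Fin n)) :=
  if h : (disjointFamilies U p m).Nonempty then PMF.uniformOfFinset (disjointFamilies U p m) h
  else PMF.pure fun _ => ∅

/-- PlayAndRecord with semi-bandit feedback: one query, of the set `S ∪ S'`, answered by a fresh
draw of the rewards; only arms of `S` are recorded. The argument and the result are pairs of the
recorded rewards vector and the number of queries made so far. -/
def playAndRecord {n : ℕ} (μ : Fin n → unitInterval) (S S' : Finset (Fin n))
    (r : (Fin n → ℕ) × ℕ) : PMF ((Fin n → ℕ) × ℕ) :=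
  (rewardLaw μ).map fun x =>
    (fun i => if i ∈ S ∧ semiBanditFeedback (S ∪ S') x i = some true then 1 else r.1 i, r.2 + 1)

/-- The top-off set: empty, unless every query has to pull exactly `k` arms and `k₁ < k`; in that
case `k - k₁` arms, taken from the rejected arms as far as possible and then from the accepted
ones. -/
def topOff {n : ℕ} (exactPulls : Bool) (k k₁ : ℕ) (A R : Finset (Fin n)) :
    PMF (Finset (Fin n)) :=
  if exactPulls = true ∧ k₁ < k then
    if R.card < k - k₁ then (unifSubset A (k - k₁ - R.card)).map fun B => R ∪ B
    else unifSubset R (k - k₁)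
  else PMF.pure ∅

/-- UniformPlay: partition `U` at random into `⌊|U| / k₁⌋` sets of size `k₁` and a remainder, and
play each of them once. Returns the recorded rewards and the number of queries made. -/
def uniformPlay {n : ℕ} (μ : Fin n → unitInterval) (exactPulls : Bool) (k k₁ : ℕ)
    (U A R : Finset (Fin n)) : PMF ((Fin n → ℕ) × ℕ) := do
  let S ← unifPartition U (U.card / k₁) k₁
  let S' ← topOff exactPulls k k₁ A R
  let r ← (List.finRange (U.card / k₁)).foldlM (fun r q => playAndRecord μ (S q) S' r)
    ((fun _ => 0), 0)
  let S₀ := U \ Finset.univ.biUnion S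
  if 0 < S₀.card then do
    let S₀' ← unifSubset (U \ S₀) (k₁ - S₀.card)
    playAndRecord μ S₀ (S₀' ∪ S') r
  else
    pure r

/-- The sum of the rewards vectors, and the total number of queries, of `T` independent calls of
UniformPlay. -/
def repeatedPlay {n : ℕ} (μ : Fin n → unitInterval) (exactPulls : Bool) (k k₁ : ℕ)
    (U A R : Finset (Fin n)) : ℕ → PMF ((Fin n → ℕ) × ℕ)
  | 0 => PMF.pure ((fun _ => 0), 0)
  | T + 1 => do
    let r ← repeatedPlay μ exactPulls k k₁ U A R T
    let y ← uniformPlay μ exactPulls k k₁ U A R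
    pure (fun i => r.1 i + y.1 i, r.2 + y.2)

/-! ### Stagewise Elimination -/

/-- The empirical variance of `2 ^ t` Bernoulli samples with empirical mean `m`. -/
def empVariance (t : ℕ) (m : ℝ) : ℝ := 2 ^ t * m * (1 - m) / (2 ^ t - 1)

/-- The width of the empirical Bernstein confidence interval at stage `t`, for an arm with empirical
mean `m`. -/
def confWidth (n : ℕ) (δ : ℝ) (t : ℕ) (m : ℝ) : ℝ :=
  √(2 * empVariance t m * Real.log (8 * n * (t : ℝ) ^ 2 / δ) / 2 ^ t) +
    8 * Real.log (8 * n * (t : ℝ) ^ 2 / δ) / (3 * (2 ^ t - 1))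

/-- The `l`-th largest of the values `f j`, `j ∈ U` (counted with multiplicity, for
`1 ≤ l ≤ |U|`). -/
def lthLargest {n : ℕ} (U : Finset (Fin n)) (f : Fin n → ℝ) (l : ℕ) : ℝ :=
  ((U.val.map f).sort (· ≥ ·)).getD (l - 1) 0

/-- The state of Stagewise Elimination at the start of a stage: the undecided, accepted and rejected
arms, and the number of queries made so far. -/
structure State (n : ℕ) where
  U : Finset (Fin n)
  A : Finset (Fin n)
  R : Finset (Fin n)
  queries : ℕ

/-- The end of stage `t`: the update of the state from the empirical means `m` and the number `q` of
queries of this stage. If the `n - k` worst arms had already been rejected when the stage began, all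
undecided arms are accepted (and then it does not matter that the `(k - |A| + 1)`-th largest element
does not exist). -/
def updateState {n : ℕ} (k : ℕ) (δ : ℝ) (t : ℕ) (s : State n) (m : Fin n → ℝ) (q : ℕ) :
    State n :=
  let lower : Fin n → ℝ := fun i => m i - confWidth n δ t (m i)
  let upper : Fin n → ℝ := fun i => m i + confWidth n δ t (m i)
  let kt := k - s.A.card
  let A₁ := s.A ∪ s.U.filter fun i => lower i > lthLargest s.U upper (kt + 1)
  let R₁ := s.R ∪ s.U.filter fun i => upper i < lthLargest s.U lower kt
  let A₂ := if s.R.card = n - k then A₁ ∪ s.U else A₁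
  { U := s.U \ (A₂ ∪ R₁), A := A₂, R := R₁, queries := s.queries + q }

/-- Stage `t`: `2 ^ t` calls of UniformPlay with `k₁ = min |U| k`, then the update. -/
def stage {n : ℕ} (μ : Fin n → unitInterval) (exactPulls : Bool) (k : ℕ) (δ : ℝ) (t : ℕ)
    (s : State n) : PMF (State n) :=
  (repeatedPlay μ exactPulls k (min s.U.card k) s.U s.A s.R (2 ^ t)).map fun r =>
    updateState k δ t s (fun i => (r.1 i : ℝ) / 2 ^ t) r.2

/-- The algorithm stops as soon as `k` arms are accepted, and returns the accepted arms. -/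
def Halted {n : ℕ} (k : ℕ) (s : State n) : Prop := k ≤ s.A.card

open Classical in
/-- Stagewise Elimination with semi-bandit feedback, cut off after stage `m`: the law of its state
when the stages `1, …, m` have been carried out (a halted run stays where it is). -/
def run {n : ℕ} (μ : Fin n → unitInterval) (exactPulls : Bool) (k : ℕ) (δ : ℝ) :
    ℕ → PMF (State n)
  | 0 => PMF.pure { U := Finset.univ, A := ∅, R := ∅, queries := 0 }
  | m + 1 => do
    let s ← run μ exactPulls k δ m
    if Halted k s then pure s else stage μ exactPulls k δ (m + 1) s

/-- The probability that Stagewise Elimination halts, in a final state that belongs to `E`. As halted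
runs are frozen, this is the increasing limit of the probabilities that it does so by stage `m`. -/
def haltProb {n : ℕ} (μ : Fin n → unitInterval) (exactPulls : Bool) (k : ℕ) (δ : ℝ)
    (E : Set (State n)) : ENNReal :=
  ⨆ m, (run μ exactPulls k δ m).toOuterMeasure {s | Halted k s ∧ s ∈ E}

/-! ### The complexity parameters -/

/-- `K` is the set of the `k` arms with the largest means, these being well defined: the `k`-th
largest mean exceeds the `(k+1)`-st. -/
def IsTop {n : ℕ} (μ : Fin n → unitInterval) (k : ℕ) (K : Finset (Fin n)) : Prop :=
  K.card = k ∧ ∀ i ∈ K, ∀ j ∉ K, (μ j : ℝ) < μ i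

/-- The gap of arm `i`: its distance to the `(k+1)`-st largest mean if `i` is a top arm, to the
`k`-th largest mean otherwise. -/
def gap {n : ℕ} (μ : Fin n → unitInterval) (K : Finset (Fin n)) (i : Fin n) : ℝ :=
  if i ∈ K then (μ i : ℝ) - ⨆ j : {j // j ∉ K}, (μ j : ℝ) else (⨅ j : {j // j ∈ K}, (μ j : ℝ)) - μ i

/-- The variance of arm `i`. -/
def armVar {n : ℕ} (μ : Fin n → unitInterval) (i : Fin n) : ℝ := μ i * (1 - μ i)

/-- `τ i`. -/
def tau {n : ℕ} (μ : Fin n → unitInterval) (K : Finset (Fin n)) (i : Fin n) : ℝ :=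
  56 / gap μ K i + 256 / gap μ K i ^ 2 *
    if i ∈ K then max (armVar μ i) (⨆ j : {j // j ∉ K}, armVar μ j)
    else max (armVar μ i) (⨆ j : {j // j ∈ K}, armVar μ j)

/-- The transformation `𝒯_{n,δ}`. -/
def bigT (n : ℕ) (δ τ : ℝ) : ℝ :=
  τ * Real.log (16 * n * Real.logb 2 (Real.exp 1) / δ *
    Real.log (8 * n * τ * Real.logb 2 (Real.exp 1) / δ))

/-- The bound on the number of queries; `t i` is the `i`-th largest of the complexities, with `i`
counted from `0`. -/
def queryBound {n : ℕ} [NeZero n] (k : ℕ) (δ : ℝ) (t : Fin n → ℝ) : ℝ :=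
  8 * bigT n δ (t 0) + 4 / k * ∑ i with k ≤ i.val, bigT n δ (t i)

/-- The simplified order of magnitude of the bound, up to logarithmic factors. -/
def queryRate {n : ℕ} [NeZero n] (k : ℕ) (δ : ℝ) (t : Fin n → ℝ) : ℝ :=
  (t 0 + 1 / k * ∑ i with k ≤ i.val, t i) * Real.log (n / δ)

end

end BestOfK

namespace BestOfK

open scoped ENNReal

/-! ### Bernstein's inequality for Bernoulli variables -/

/-! Under semi-bandit feedback each undecided arm is recorded exactly once per round, whatever the
random partition and top-off set, so a stage yields `T` independent Bernoulli samples of every arm.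
Uniformity of the partition and dependence between arms play no role: only one-arm marginals and a
union bound are used.

Bernstein's inequality (`bernstein`) bounds each empirical mean. It implies, deterministically, that
the empirical confidence intervals cover the means (`abs_sub_le_empirical`) and that their widths
are bounded in terms of the true variances (`empirical_le`). If all intervals of a stage cover, no
arm is misclassified (`not_upper_lt`, `not_lt_lower`), and an arm whose interval is disjoint from
those of all undecided arms on the other side of `K` is decided (`notMem_updateState_U`). The
constants in `τ` make this happen once `2 ^ t` reaches `bigT n δ τ` (`log_div_mul_le`,
`width_lt_gap`).

The invariant `Good` combines correctness, decidedness and a query budget. Stage `t` breaks it with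
probability at most `δ / (4 t²)`, which sums to at most `δ`. The queries are counted by charging
each round to the arm of largest complexity and, with weight `1 / k`, to the undecided arms beyond
position `k` (`queryBudget_add_le`). Since stage lengths double, the last stage in which an arm
takes part dominates its total. -/

lemma exp_le_quadratic_of_nonneg {x : ℝ} (hx : 0 ≤ x) (hx3 : x < 3) :
    Real.exp x ≤ 1 + x + x ^ 2 / (2 * (1 - x / 3)) := by
  -- Up to the factor 3, the difference of the two sides is the derivative of the function in the
  -- second monotonicity argument.
  have key : ∀ y : ℝ, 0 ≤ y → (2 - y) * Real.exp y ≤ 2 + y := by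
    have hmono : MonotoneOn (fun y : ℝ => 2 + y - (2 - y) * Real.exp y) (Set.Ici 0) := by
      refine monotoneOn_of_hasDerivWithinAt_nonneg (convex_Ici 0) (by fun_prop)
        (f' := fun y => 1 - (1 - y) * Real.exp y) (fun y _ => ?_) (fun y hy => ?_)
      · have h := ((hasDerivAt_id y).const_add 2).sub
          (((hasDerivAt_id y).const_sub 2).mul (Real.hasDerivAt_exp y))
        refine (h.congr_deriv ?_).hasDerivWithinAt
        simp; ring
      · have h := Real.add_one_le_exp (-y)
        have h2 : Real.exp (-y) * Real.exp y = 1 := by rw [← Real.exp_add]; simp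
        nlinarith [Real.exp_pos y]
    intro y hy
    have := hmono (Set.mem_Ici.2 le_rfl) (Set.mem_Ici.2 hy) hy
    simp at this
    linarith
  have hmono : MonotoneOn (fun y : ℝ => y ^ 2 / 2 - (1 - y / 3) * (Real.exp y - 1 - y))
      (Set.Ici 0) := by
    refine monotoneOn_of_hasDerivWithinAt_nonneg (convex_Ici 0) (by fun_prop)
      (f' := fun y => (2 + y - (2 - y) * Real.exp y) / 3) (fun y _ => ?_) (fun y hy => ?_)
    · have h := (((hasDerivAt_id y).pow 2).div_const 2).sub
        ((((hasDerivAt_id y).div_const 3).const_sub 1).mul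
          (((Real.hasDerivAt_exp y).sub_const 1).sub (hasDerivAt_id y)))
      refine (h.congr_deriv ?_).hasDerivWithinAt
      simp; ring
    · simp only [interior_Ici, Set.mem_Ioi] at hy
      have := key y hy.le
      apply div_nonneg <;> linarith
  have h := hmono (Set.mem_Ici.2 le_rfl) (Set.mem_Ici.2 hx) hx
  simp only [] at h
  have h0 : 0 < 1 - x / 3 := by linarith
  have : (1 - x / 3) * (Real.exp x - 1 - x) ≤ x ^ 2 / 2 := by
    simp at h; linarith
  have h2 : Real.exp x - 1 - x ≤ x ^ 2 / 2 / (1 - x / 3) := by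
    rw [le_div_iff₀ h0]; linarith
  have h3 : x ^ 2 / (2 * (1 - x / 3)) = x ^ 2 / 2 / (1 - x / 3) := by rw [div_div]
  linarith

lemma exp_neg_le_quadratic {x : ℝ} (hx : 0 ≤ x) :
    Real.exp (-x) ≤ 1 - x + x ^ 2 / 2 := by
  have hmono : MonotoneOn (fun y : ℝ => 1 - y + y ^ 2 / 2 - Real.exp (-y)) (Set.Ici 0) := by
    refine monotoneOn_of_hasDerivWithinAt_nonneg (convex_Ici 0) (by fun_prop)
      (f' := fun y => -1 + y + Real.exp (-y)) (fun y _ => ?_) (fun y hy => ?_)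
    · have h := ((((hasDerivAt_id y).const_sub 1).add
        (((hasDerivAt_id y).pow 2).div_const 2))).sub ((hasDerivAt_id y).neg.exp)
      refine (h.congr_deriv ?_).hasDerivWithinAt
      simp
    · have := Real.add_one_le_exp (-y)
      linarith
  have h := hmono (Set.mem_Ici.2 le_rfl) (Set.mem_Ici.2 hx) hx
  simp at h
  linarith

/-- The centred moment generating function of a Bernoulli variable is sub-gamma. -/
lemma bernoulli_mgf_le {p s : ℝ} (hp : 0 ≤ p) (hp1 : p ≤ 1) (hs : 0 ≤ s) (hs3 : s < 3) :
    (1 - p) * Real.exp (s * -p) + p * Real.exp (s * (1 - p)) ≤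
      Real.exp (p * (1 - p) * (s ^ 2 / (2 * (1 - s / 3)))) := by
  have h0 : 0 < 1 - s / 3 := by linarith
  have hc : s ^ 2 / 2 ≤ s ^ 2 / (2 * (1 - s / 3)) := by
    apply div_le_div_of_nonneg_left <;> nlinarith
  have h1 : Real.exp (s * -p) ≤ 1 - s * p + p ^ 2 * (s ^ 2 / (2 * (1 - s / 3))) := by
    have := exp_neg_le_quadratic (mul_nonneg hs hp)
    rw [mul_neg]
    nlinarith [mul_le_mul_of_nonneg_left hc (sq_nonneg p)]
  have h2 : Real.exp (s * (1 - p)) ≤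
      1 + s * (1 - p) + (1 - p) ^ 2 * (s ^ 2 / (2 * (1 - s / 3))) := by
    have hsp : s * (1 - p) ≤ s := by nlinarith
    have h := exp_le_quadratic_of_nonneg (mul_nonneg hs (by linarith : 0 ≤ 1 - p)) (by linarith)
    have h3 : (s * (1 - p)) ^ 2 / (2 * (1 - s * (1 - p) / 3)) ≤
        (s * (1 - p)) ^ 2 / (2 * (1 - s / 3)) := by
      apply div_le_div_of_nonneg_left <;> nlinarith
    have h4 : (s * (1 - p)) ^ 2 / (2 * (1 - s / 3)) =
      (1 - p) ^ 2 * (s ^ 2 / (2 * (1 - s / 3))) := by ring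
    linarith
  set g := s ^ 2 / (2 * (1 - s / 3))
  -- Averaging the two quadratic bounds cancels the linear terms, and `(1 - p) p² + p (1 - p)² = p
  -- (1 - p)`.
  have h3 := Real.add_one_le_exp (p * (1 - p) * g)
  nlinarith [mul_le_mul_of_nonneg_left h1 (by linarith : 0 ≤ 1 - p),
    mul_le_mul_of_nonneg_left h2 hp]

/-- The radius of Bernstein's inequality for the mean of Bernoulli samples with variance `v`. -/
noncomputable def bernsteinRadius (v l : ℝ) : ℝ := √(2 * v * l) + l / 3

/-- Selects the Chernoff parameter for which the sub-gamma bound, evaluated at Bernstein's radius,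
gives an exponent of exactly `-l` per sample. -/
lemma exists_bernoulli_mgf_le {p l : ℝ} (hp : 0 ≤ p) (hp1 : p ≤ 1) (hl : 0 < l) :
    ∃ s : ℝ, 0 ≤ s ∧ (1 - p) * Real.exp (s * -p) + p * Real.exp (s * (1 - p)) ≤
      Real.exp (s * bernsteinRadius (p * (1 - p)) l - l) := by
  rcases (mul_nonneg hp (by linarith : 0 ≤ 1 - p)).eq_or_lt with hV | hV
  -- With zero variance the variable is constant and the radius is `l / 3`, so `s = 3` makes both
  -- sides equal to 1.
  · refine ⟨3, by norm_num, ?_⟩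
    have : (3 : ℝ) * bernsteinRadius (p * (1 - p)) l - l = 0 := by
      rw [bernsteinRadius, ← hV]; simp; ring
    rw [this]
    rcases mul_eq_zero.1 hV.symm with h | h
    · simp [h]
    · have : p = 1 := by linarith
      simp [this]
  · set v := p * (1 - p) with hv
    -- `u` is the optimal parameter of the Gaussian part. Damping it to `u / (1 + u / 3)` keeps it
    -- below 3 and makes both exponents equal to `l / (1 + u / 3)`.
    set u := √(2 * l / v) with hu
    have hu0 : 0 < u := Real.sqrt_pos.2 (by positivity)
    have huv : u ^ 2 * v = 2 * l := by
      rw [hu, Real.sq_sqrt (by positivity)]; field_simp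
    have hub : u * √(2 * v * l) = 2 * l := by
      rw [hu, ← Real.sqrt_mul (by positivity)]
      have : 2 * l / v * (2 * v * l) = (2 * l) ^ 2 := by field_simp
      rw [this, Real.sqrt_sq (by positivity)]
    have h1 : 0 < 1 + u / 3 := by positivity
    have hs3 : u / (1 + u / 3) < 3 := by rw [div_lt_iff₀ h1]; linarith
    refine ⟨u / (1 + u / 3), by positivity, (bernoulli_mgf_le hp hp1 (by positivity) hs3).trans
      (Real.exp_le_exp.2 (le_of_eq ?_))⟩
    have h2 : 1 - u / (1 + u / 3) / 3 = 1 / (1 + u / 3) := by field_simp; ring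
    have h3 : u / (1 + u / 3) * bernsteinRadius v l = (2 * l + u * l / 3) / (1 + u / 3) := by
      rw [bernsteinRadius, ← hub]; field_simp
    have h4 : p * (1 - p) * ((u / (1 + u / 3)) ^ 2 / (2 * (1 - u / (1 + u / 3) / 3))) =
        l / (1 + u / 3) := by
      rw [h2, ← hv]
      have : l = u ^ 2 * v / 2 := by linarith
      rw [this]; field_simp
    rw [h4, h3]
    field_simp
    ring

/-! ### Confidence widths -/

/-- The factor `T / (T - 1)` of the empirical variance is absorbed, so that both terms depend on the
single deviation parameter `l = log (8 n t² / δ) / (T - 1)`. -/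
lemma confWidth_eq {n t : ℕ} {δ m : ℝ} (ht : 1 ≤ t) :
    confWidth n δ t m =
      √(2 * (m * (1 - m)) * (Real.log (8 * n * (t : ℝ) ^ 2 / δ) / (2 ^ t - 1))) +
        8 / 3 * (Real.log (8 * n * (t : ℝ) ^ 2 / δ) / (2 ^ t - 1)) := by
  have h : (2 : ℝ) ≤ 2 ^ t := by
    calc (2 : ℝ) = 2 ^ 1 := by norm_num
      _ ≤ 2 ^ t := pow_le_pow_right₀ (by norm_num) ht
  have h1 : (2 : ℝ) ^ t - 1 ≠ 0 := by linarith
  rw [confWidth, empVariance]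
  congr 2
  · field_simp
  · field_simp

/-- Bernstein's inequality implies its empirical version. -/
lemma abs_sub_le_empirical {p m l : ℝ} (hp : 0 ≤ p) (hp1 : p ≤ 1) (hm : 0 ≤ m) (hm1 : m ≤ 1)
    (hl : 0 ≤ l) (h : |m - p| ≤ bernsteinRadius (p * (1 - p)) l) :
    |m - p| ≤ √(2 * (m * (1 - m)) * l) + 8 / 3 * l := by
  set d := |m - p| with hd
  have hd0 : 0 ≤ d := abs_nonneg _
  -- The variance is 1-Lipschitz in the mean: the difference is `(p - m) (1 - p - m)`.
  have hV : p * (1 - p) ≤ m * (1 - m) + d := by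
    rcases abs_cases (m - p) with ⟨h1, h2⟩ | ⟨h1, h2⟩ <;> rw [hd, h1] <;> nlinarith
  have hw : 0 ≤ m * (1 - m) := mul_nonneg hm (by linarith)
  set w := m * (1 - m)
  have h1 : √(2 * (p * (1 - p)) * l) ≤ √(2 * (w + d) * l) :=
    Real.sqrt_le_sqrt (by nlinarith)
  rw [bernsteinRadius] at h
  by_contra! hlt
  set a := √(2 * w * l) with ha
  have ha0 : 0 ≤ a := Real.sqrt_nonneg _
  have ha2 : a ^ 2 = 2 * w * l := Real.sq_sqrt (by positivity)
  have h2 : d - l / 3 ≤ √(2 * (w + d) * l) := by linarith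
  have h3 : (d - l / 3) ^ 2 ≤ 2 * (w + d) * l := by
    calc (d - l / 3) ^ 2 ≤ √(2 * (w + d) * l) ^ 2 :=
          pow_le_pow_left₀ (by linarith) h2 2
      _ = _ := Real.sq_sqrt (by positivity)
  -- Expanding `h3` gives `d (d - 8 l / 3) ≤ a² - l² / 9`, against `d > a + 8 l / 3`. Here `8 / 3 =
  -- 2 + 2 / 3` collects the two cross terms.
  nlinarith [mul_nonneg ha0 hl, mul_nonneg hl hl]

/-- The empirical confidence width is at most its population version. -/
lemma empirical_le {p m l : ℝ} (hp : 0 ≤ p) (hp1 : p ≤ 1)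
    (hl : 0 ≤ l) (h : |m - p| ≤ bernsteinRadius (p * (1 - p)) l) :
    √(2 * (m * (1 - m)) * l) + 8 / 3 * l ≤ √(2 * (p * (1 - p)) * l) + 11 / 3 * l := by
  set d := |m - p| with hd
  have hd0 : 0 ≤ d := abs_nonneg _
  have hw : m * (1 - m) ≤ p * (1 - p) + d := by
    rcases abs_cases (m - p) with ⟨h1, h2⟩ | ⟨h1, h2⟩ <;> rw [hd, h1] <;> nlinarith
  have hv : 0 ≤ p * (1 - p) := mul_nonneg hp (by linarith)
  set v := p * (1 - p)
  rw [bernsteinRadius] at h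
  set a := √(2 * v * l) with ha
  have ha0 : 0 ≤ a := Real.sqrt_nonneg _
  have ha2 : a ^ 2 = 2 * v * l := Real.sq_sqrt (by positivity)
  -- Since `d ≤ a + l / 3`, the radicand is at most `a² + 2 a l + 2 l² / 3 ≤ (a + l)²`. The extra
  -- `l` turns `8 / 3` into `11 / 3`.
  have : √(2 * (m * (1 - m)) * l) ≤ a + l := by
    apply Real.sqrt_le_iff.2 ⟨by positivity, ?_⟩
    nlinarith [mul_nonneg ha0 hl, mul_nonneg hl hl]
  linarith

lemma bernsteinRadius_mono {v l l' : ℝ} (hv : 0 ≤ v) (h : l ≤ l') :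
    bernsteinRadius v l ≤ bernsteinRadius v l' := by
  unfold bernsteinRadius
  have : √(2 * v * l) ≤ √(2 * v * l') := Real.sqrt_le_sqrt (by nlinarith)
  linarith

/-- If `l ≤ 3 / τ`, four confidence widths fit into the gap. -/
lemma width_lt_gap {v l Δ : ℝ} (hv : 0 ≤ v) (hΔ : 0 < Δ) (hl : 0 ≤ l)
    (h : l * (56 / Δ + 256 / Δ ^ 2 * v) ≤ 3) :
    4 * (√(2 * v * l) + 11 / 3 * l) < Δ := by
  set a := √(2 * v * l) with ha
  have ha2 : a ^ 2 = 2 * v * l := Real.sq_sqrt (by positivity)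
  have h1 : 56 * (l / Δ) + 128 * (a / Δ) ^ 2 ≤ 3 := by
    have : l * (56 / Δ + 256 / Δ ^ 2 * v) = 56 * (l / Δ) + 128 * (a / Δ) ^ 2 := by
      rw [div_pow, ha2]; field_simp; ring
    linarith
  -- Eliminating `l / Δ` by `h1` leaves a concave quadratic in `a / Δ` whose maximizer is about
  -- `0.06` and whose maximum is below 1.
  have h2 : 4 * (a / Δ + 11 / 3 * (l / Δ)) < 1 := by nlinarith [sq_nonneg (a / Δ - 0.06)]
  have h3 : 4 * (a / Δ + 11 / 3 * (l / Δ)) = 4 * (a + 11 / 3 * l) / Δ := by ring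
  rw [h3, div_lt_one hΔ] at h2
  exact h2

/-! ### The transformation `𝒯` -/

lemma logb_two_exp_one : Real.logb 2 (Real.exp 1) = (Real.log 2)⁻¹ := by
  rw [Real.logb, Real.log_exp, one_div]

lemma logb_two_exp_one_bounds :
    1.44 ≤ Real.logb 2 (Real.exp 1) ∧ Real.logb 2 (Real.exp 1) ≤ 1.45 := by
  have h1 := Real.log_two_gt_d9
  have h2 := Real.log_two_lt_d9
  rw [logb_two_exp_one]
  constructor
  · rw [le_inv_comm₀ (by norm_num) (by linarith)]
    norm_num at h2 ⊢; linarith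
  · rw [inv_le_comm₀ (by linarith) (by norm_num)]
    norm_num at h1 ⊢; linarith

/-- The constant `8 n log₂ e / δ` of the transformation `𝒯`. -/
noncomputable def scale (n : ℕ) (δ : ℝ) : ℝ := 8 * n * Real.logb 2 (Real.exp 1) / δ

lemma bigT_eq (n : ℕ) (δ τ : ℝ) :
    bigT n δ τ = τ * Real.log (2 * scale n δ * Real.log (scale n δ * τ)) := by
  rw [bigT, scale]
  congr 3
  · ring
  · congr 1; ring

section
variable {n : ℕ} {δ τ : ℝ}

lemma scale_ge (hn : 2 ≤ n) (hδ : 0 < δ) (hδ1 : δ < 1) : 23 ≤ scale n δ := by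
  have h := logb_two_exp_one_bounds.1
  have hn' : (2 : ℝ) ≤ n := by exact_mod_cast hn
  rw [scale, le_div_iff₀ hδ]
  nlinarith

lemma log_scale_mul_ge (hn : 2 ≤ n) (hδ : 0 < δ) (hδ1 : δ < 1) (hτ : 56 ≤ τ) :
    2 ≤ Real.log (scale n δ * τ) := by
  have h := scale_ge hn hδ hδ1
  rw [Real.le_log_iff_exp_le (by nlinarith)]
  have h1 : Real.exp 2 = Real.exp 1 * Real.exp 1 := by rw [← Real.exp_add]; norm_num
  have := Real.exp_one_lt_d9
  have := Real.exp_pos 1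
  nlinarith

lemma one_le_log (hn : 2 ≤ n) (hδ : 0 < δ) (hδ1 : δ < 1) (hτ : 56 ≤ τ) :
    1 ≤ Real.log (2 * scale n δ * Real.log (scale n δ * τ)) := by
  have h := scale_ge hn hδ hδ1
  have h2 := log_scale_mul_ge hn hδ hδ1 hτ
  rw [Real.le_log_iff_exp_le (by nlinarith)]
  have := Real.exp_one_lt_d9
  nlinarith

lemma le_bigT (hn : 2 ≤ n) (hδ : 0 < δ) (hδ1 : δ < 1) (hτ : 56 ≤ τ) : τ ≤ bigT n δ τ := by
  rw [bigT_eq]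
  nlinarith [one_le_log hn hδ hδ1 hτ]

lemma bigT_mono {τ' : ℝ} (hn : 2 ≤ n) (hδ : 0 < δ) (hδ1 : δ < 1) (hτ : 56 ≤ τ) (h : τ ≤ τ') :
    bigT n δ τ ≤ bigT n δ τ' := by
  have hM := scale_ge hn hδ hδ1
  have h1 := one_le_log hn hδ hδ1 hτ
  have h2 := log_scale_mul_ge hn hδ hδ1 hτ
  have h3 : Real.log (scale n δ * τ) ≤ Real.log (scale n δ * τ') :=
    Real.log_le_log (by nlinarith) (by nlinarith)
  have h4 : Real.log (2 * scale n δ * Real.log (scale n δ * τ)) ≤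
      Real.log (2 * scale n δ * Real.log (scale n δ * τ')) :=
    Real.log_le_log (by nlinarith) (by nlinarith)
  rw [bigT_eq, bigT_eq]
  nlinarith

/-- Once the number of samples has reached `𝒯(τ)`, the deviation parameter is of order `1 / τ`. -/
lemma log_div_mul_le {t : ℕ} (hn : 2 ≤ n) (hδ : 0 < δ) (hδ1 : δ < 1) (hτ : 56 ≤ τ)
    (h : bigT n δ τ ≤ 2 ^ t) :
    Real.log (8 * n * (t : ℝ) ^ 2 / δ) / (2 ^ t - 1) * τ ≤ 3 := by
  have hM := scale_ge hn hδ hδ1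
  have hlog := log_scale_mul_ge hn hδ hδ1 hτ
  have hone := one_le_log hn hδ hδ1 hτ
  have hτT := le_bigT hn hδ hδ1 hτ
  obtain ⟨he1, he2⟩ := logb_two_exp_one_bounds
  set x : ℝ := 2 ^ t with hx
  set y := x / τ with hy
  have hxy : x = y * τ := by rw [hy]; field_simp
  have hy0 : Real.log (2 * scale n δ * Real.log (scale n δ * τ)) ≤ y := by
    rw [hy, le_div_iff₀ (by linarith)]
    rw [bigT_eq] at h; linarith
  have hypos : 0 < y := by linarith
  have hey : 2 * scale n δ * Real.log (scale n δ * τ) ≤ Real.exp y :=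
    (Real.log_le_iff_le_exp (by nlinarith)).1 hy0
  -- The stage number is itself logarithmic in the sample size, which is why `bigT` contains an
  -- iterated logarithm.
  have ht : (t : ℝ) = Real.logb 2 (Real.exp 1) * Real.log x := by
    rw [hx, Real.log_pow, logb_two_exp_one]
    have := Real.log_pos (one_lt_two (α := ℝ))
    field_simp
  have hlx : Real.log x = Real.log y + Real.log τ := by
    rw [hxy, Real.log_mul hypos.ne' (by linarith)]
  have hlx0 : 0 ≤ Real.log x := Real.log_nonneg (by linarith)
  -- Everything is compared with powers of `r`: `log y ≤ r`, `log τ ≤ r² / (2 M)` and `4 M ≤ r²`.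
  -- Then `M log₂ e (log x)² ≤ r⁴ = exp (2 y)`.
  set r := Real.exp (y / 2) with hr
  have hr2 : r ^ 2 = Real.exp y := by
    rw [hr, ← Real.exp_nat_mul]; congr 1; push_cast; ring
  have hr0 : 0 < r := Real.exp_pos _
  have hly : Real.log y ≤ r := by
    have h1 := Real.log_le_sub_one_of_pos (half_pos hypos)
    have h2 := Real.add_one_le_exp (y / 2)
    have h3 : Real.log (y / 2) = Real.log y - Real.log 2 :=
      Real.log_div hypos.ne' (by norm_num)
    have h4 := Real.log_two_lt_d9
    norm_num at h4
    linarith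
  set M := scale n δ with hMdef
  have hlτ : Real.log τ ≤ Real.log (M * τ) :=
    Real.log_le_log (by linarith) (by nlinarith)
  have hlτ2 : Real.log τ * (2 * M) ≤ r ^ 2 := by
    rw [hr2]; nlinarith
  have hr4M : 4 * M ≤ r ^ 2 := by rw [hr2]; nlinarith
  have hr8 : 8 ≤ r := by nlinarith
  have hlx2 : Real.log x ≤ r + r ^ 2 / (2 * M) := by
    have : Real.log τ ≤ r ^ 2 / (2 * M) := by rw [le_div_iff₀ (by linarith)]; exact hlτ2
    linarith
  have harg : 8 * n * (t : ℝ) ^ 2 / δ = M * Real.logb 2 (Real.exp 1) * Real.log x ^ 2 := by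
    rw [ht, hMdef, scale]; ring
  have hle : M * Real.logb 2 (Real.exp 1) * Real.log x ^ 2 ≤ Real.exp (2 * y) := by
    have h1 : Real.exp (2 * y) = r ^ 2 * r ^ 2 := by
      rw [hr2, ← Real.exp_add]; congr 1; ring
    have h2 : M * Real.logb 2 (Real.exp 1) * Real.log x ^ 2 ≤
        M * 1.45 * (r + r ^ 2 / (2 * M)) ^ 2 := by
      gcongr
    have h3 : M * 1.45 * (r + r ^ 2 / (2 * M)) ^ 2 =
        r ^ 2 * (1.45 * M + 1.45 * r + 0.3625 * (r ^ 2 / M)) := by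
      field_simp; ring
    have h4 : r ^ 2 / M ≤ r ^ 2 / 16 := by gcongr; linarith
    rw [h1]
    refine h2.trans (h3.le.trans ?_)
    gcongr
    nlinarith
  have hpos : 0 < 8 * n * (t : ℝ) ^ 2 / δ := by
    have hlx0 : 0 < Real.log x := Real.log_pos (by linarith)
    rw [harg]; positivity
  have hL : Real.log (8 * n * (t : ℝ) ^ 2 / δ) ≤ 2 * y := by
    rw [Real.log_le_iff_le_exp hpos, harg]; exact hle
  have hx1 : 0 < x - 1 := by linarith
  -- It remains that `2 y τ = 2 x ≤ 3 (x - 1)`, which holds because `x ≥ 56`.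
  rw [div_mul_eq_mul_div, div_le_iff₀ hx1]
  nlinarith

/-- The inner logarithm is bounded crudely by its argument, so the outer one is at most `log 2 + 2
log M + log τ`. With `log 2 ≤ Λ`, `log M ≤ 5 Λ`, `log τ ≤ 2 log Z`, `Λ ≥ 0.69` and `log Z ≥ 1` this
is at most `14 Λ log Z`. -/
lemma bigT_le_rate {τ' Z : ℝ} (hn : 2 ≤ n) (hδ : 0 < δ) (hδ1 : δ < 1) (hτ : 56 ≤ τ)
    (h : τ ≤ τ') (hZ : τ' * Real.log (n / δ) ≤ Z) :
    bigT n δ τ ≤ 14 * τ * Real.log (n / δ) * Real.log Z := by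
  have hM := scale_ge hn hδ hδ1
  have hlog := log_scale_mul_ge hn hδ hδ1 hτ
  obtain ⟨he1, he2⟩ := logb_two_exp_one_bounds
  have hn' : (2 : ℝ) ≤ n := by exact_mod_cast hn
  have hnδ : 2 ≤ n / δ := by rw [le_div_iff₀ hδ]; nlinarith
  have hΛ2 : Real.log 2 ≤ Real.log (n / δ) := Real.log_le_log (by norm_num) hnδ
  have hl2 : 0.69 ≤ Real.log 2 := by
    have := Real.log_two_gt_d9; norm_num at this ⊢; linarith
  have hMe : scale n δ ≤ 16 * (n / δ) := by
    rw [scale]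
    calc 8 * n * Real.logb 2 (Real.exp 1) / δ = 8 * Real.logb 2 (Real.exp 1) * (n / δ) := by ring
      _ ≤ 16 * (n / δ) := by
        refine mul_le_mul_of_nonneg_right (by linarith) (by linarith)
  have hlM : Real.log (scale n δ) ≤ 5 * Real.log (n / δ) := by
    have h1 := Real.log_le_log (by linarith) hMe
    rw [Real.log_mul (by norm_num) (by linarith)] at h1
    have h2 : Real.log 16 = 4 * Real.log 2 := by
      rw [show (16 : ℝ) = 2 ^ 4 by norm_num, Real.log_pow]; norm_num
    linarith
  set Λ := Real.log (n / δ) with hΛ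
  have hZ38 : 38 ≤ Z := by nlinarith
  have hτZ : τ ≤ Z ^ 2 := by nlinarith
  have hlτ : Real.log τ ≤ 2 * Real.log Z := by
    have := Real.log_le_log (by linarith) hτZ
    rw [Real.log_pow] at this; exact_mod_cast this
  have hlZ : 1 ≤ Real.log Z := by
    rw [Real.le_log_iff_exp_le (by linarith)]
    have := Real.exp_one_lt_d9
    linarith
  set M := scale n δ with hMdef
  have h1 : Real.log (2 * M * Real.log (M * τ)) ≤ Real.log 2 + 2 * Real.log M + Real.log τ := by
    have h2 : Real.log (M * τ) ≤ M * τ :=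
      (Real.log_le_sub_one_of_pos (by nlinarith)).trans (by linarith)
    have h3 : 2 * M * Real.log (M * τ) ≤ 2 * M * (M * τ) := by gcongr
    refine (Real.log_le_log (by nlinarith) h3).trans (le_of_eq ?_)
    rw [Real.log_mul (by linarith) (by nlinarith), Real.log_mul (by norm_num) (by linarith),
      Real.log_mul (by linarith) (by linarith)]
    ring
  have h2 : Real.log (2 * M * Real.log (M * τ)) ≤ 14 * Λ * Real.log Z := by nlinarith
  rw [bigT_eq]
  calc τ * Real.log (2 * M * Real.log (M * τ)) ≤ τ * (14 * Λ * Real.log Z) := by gcongr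
    _ = _ := by ring

/-- The bound on the number of queries is of the order of the rate, up to a logarithm. -/
lemma queryBound_le_rate [NeZero n] {k : ℕ} (hn : 2 ≤ n) (hk : 1 ≤ k) (hδ : 0 < δ) (hδ1 : δ < 1)
    {t : Fin n → ℝ} (ht : Antitone t) (ht56 : ∀ i, 56 ≤ t i) :
    queryBound k δ t ≤ 112 * queryRate k δ t * Real.log (queryRate k δ t) ^ 1 := by
  have hn' : (2 : ℝ) ≤ n := by exact_mod_cast hn
  have hΛ0 : 0 ≤ Real.log (n / δ) := Real.log_nonneg (by rw [le_div_iff₀ hδ]; nlinarith)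
  have hk' : (0 : ℝ) < k := by exact_mod_cast hk
  have hs : 0 ≤ ∑ i with k ≤ i.val, t i := Finset.sum_nonneg fun i _ => by linarith [ht56 i]
  have hZ : t 0 * Real.log (n / δ) ≤ queryRate k δ t := by
    rw [queryRate]
    refine mul_le_mul_of_nonneg_right ?_ hΛ0
    have : 0 ≤ 1 / (k : ℝ) * ∑ i with k ≤ i.val, t i := by positivity
    linarith
  have hb : ∀ i, bigT n δ (t i) ≤
      14 * t i * Real.log (n / δ) * Real.log (queryRate k δ t) := fun i =>
    bigT_le_rate hn hδ hδ1 (ht56 i) (ht (Fin.zero_le i)) hZ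
  set X := Real.log (queryRate k δ t) with hX
  have hX0 : 0 ≤ X := by
    refine Real.log_nonneg ?_
    have h2 : Real.log 2 ≤ Real.log (n / δ) :=
      Real.log_le_log (by norm_num) (by rw [le_div_iff₀ hδ]; nlinarith)
    have := Real.log_two_gt_d9
    norm_num at this
    nlinarith [ht56 0]
  have h1 : ∑ i with k ≤ i.val, bigT n δ (t i) ≤
      14 * (∑ i with k ≤ i.val, t i) * Real.log (n / δ) * X := by
    rw [Finset.mul_sum, Finset.sum_mul, Finset.sum_mul]
    exact Finset.sum_le_sum fun i _ => hb i
  -- The constant is `112 = 8 * 14`; the sum only needs `4 * 14 = 56`.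
  rw [queryBound, queryRate, pow_one]
  have h2 : 4 / (k : ℝ) * ∑ i with k ≤ i.val, bigT n δ (t i) ≤
      4 / k * (14 * (∑ i with k ≤ i.val, t i) * Real.log (n / δ) * X) := by gcongr
  have h3 : 0 ≤ 1 / (k : ℝ) * (∑ i with k ≤ i.val, t i) * Real.log (n / δ) * X := by positivity
  have h4 : 4 / k * (14 * (∑ i with k ≤ i.val, t i) * Real.log (n / δ) * X) =
      56 * (1 / (k : ℝ) * (∑ i with k ≤ i.val, t i) * Real.log (n / δ) * X) := by ring
  have h5 := hb 0
  nlinarith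

end

/-! ### Expectations with respect to a probability mass function -/

/-- The expectation of a nonnegative function. -/
noncomputable def expect {α : Type} (p : PMF α) (f : α → ℝ≥0∞) : ℝ≥0∞ := ∑' a, p a * f a

section expect
variable {α β : Type}

lemma pmf_bind_eq_bind (p : PMF α) (f : α → PMF β) : (p >>= f) = p.bind f := rfl

lemma pmf_pure_eq_pure (a : α) : (pure a : PMF α) = PMF.pure a := rfl

lemma expect_bind (p : PMF α) (g : α → PMF β) (f : β → ℝ≥0∞) :
    expect (p.bind g) f = expect p fun a => expect (g a) f := by
  simp only [expect, PMF.bind_apply, ← ENNReal.tsum_mul_left, ← ENNReal.tsum_mul_right]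
  rw [ENNReal.tsum_comm]
  simp only [mul_assoc]

@[simp] lemma expect_pure (a : α) (f : α → ℝ≥0∞) : expect (PMF.pure a) f = f a := by
  rw [expect, tsum_eq_single a]
  · simp
  · intro b hb; simp [PMF.pure_apply, hb]

lemma expect_map (p : PMF α) (g : α → β) (f : β → ℝ≥0∞) :
    expect (p.map g) f = expect p fun a => f (g a) := by
  rw [← PMF.bind_pure_comp, expect_bind]; simp

/-- Sure properties of the samples, such as query counts and ranges of recorded rewards, enter
expectations through this comparison. -/
lemma expect_mono_support {p : PMF α} {f g : α → ℝ≥0∞} (h : ∀ a ∈ p.support, f a ≤ g a) :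
    expect p f ≤ expect p g := by
  refine ENNReal.tsum_le_tsum fun a => ?_
  by_cases ha : a ∈ p.support
  · gcongr; exact h a ha
  · rw [PMF.mem_support_iff, not_not] at ha; simp [ha]

lemma expect_mono {p : PMF α} {f g : α → ℝ≥0∞} (h : ∀ a, f a ≤ g a) : expect p f ≤ expect p g :=
  expect_mono_support fun a _ => h a

lemma expect_congr_support {p : PMF α} {f g : α → ℝ≥0∞} (h : ∀ a ∈ p.support, f a = g a) :
    expect p f = expect p g :=
  le_antisymm (expect_mono_support fun a ha => (h a ha).le)
    (expect_mono_support fun a ha => (h a ha).ge)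

@[simp] lemma expect_const (p : PMF α) (c : ℝ≥0∞) : expect p (fun _ => c) = c := by
  rw [expect, ENNReal.tsum_mul_right, p.tsum_coe, one_mul]

lemma expect_add (p : PMF α) (f g : α → ℝ≥0∞) :
    expect p (fun a => f a + g a) = expect p f + expect p g := by
  simp only [expect, mul_add, ENNReal.tsum_add]

lemma expect_const_mul (p : PMF α) (c : ℝ≥0∞) (f : α → ℝ≥0∞) :
    expect p (fun a => c * f a) = c * expect p f := by
  simp only [expect, ← ENNReal.tsum_mul_left]
  exact tsum_congr fun a => by ring

lemma expect_mul_const (p : PMF α) (c : ℝ≥0∞) (f : α → ℝ≥0∞) :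
    expect p (fun a => f a * c) = expect p f * c := by
  simp only [mul_comm _ c, expect_const_mul]

lemma expect_finset_sum {ι : Type} (p : PMF α) (s : Finset ι) (f : ι → α → ℝ≥0∞) :
    expect p (fun a => ∑ i ∈ s, f i a) = ∑ i ∈ s, expect p (f i) := by
  classical
  induction s using Finset.induction_on with
  | empty => simp
  | insert i s hi ih => simp only [Finset.sum_insert hi, expect_add, ih]

open Classical in
lemma toOuterMeasure_eq_expect (p : PMF α) (s : Set α) :
    p.toOuterMeasure s = expect p fun a => if a ∈ s then 1 else 0 := by
  rw [PMF.toOuterMeasure_apply, expect]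
  refine tsum_congr fun a => ?_
  by_cases h : a ∈ s <;> simp [h]

end expect

/-! ### The law of the recorded rewards -/

/-- The expectation of `f` under the Bernoulli distribution with mean `p`. -/
noncomputable def bernoulliExpect (p : unitInterval) (f : ℕ → ℝ≥0∞) : ℝ≥0∞ :=
  ENNReal.ofReal (1 - p) * f 0 + ENNReal.ofReal p * f 1

section law
variable {n : ℕ} (μ : Fin n → unitInterval)

lemma ofReal_sub_add_ofReal (p : unitInterval) :
    ENNReal.ofReal (1 - (p : ℝ)) + ENNReal.ofReal p = 1 := by
  rw [← ENNReal.ofReal_add (sub_nonneg.2 p.2.2) p.2.1]; simp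

/-- A function of one coordinate is a product with trivial factors elsewhere, so the sum over all
reward vectors factorizes and the other coordinates contribute their total mass 1. -/
lemma expect_rewardLaw (i : Fin n) (h : Bool → ℝ≥0∞) :
    expect (rewardLaw μ) (fun x => h (x i)) =
      ENNReal.ofReal (1 - μ i) * h false + ENNReal.ofReal (μ i) * h true := by
  classical
  have h1 : ∀ x : Fin n → Bool, rewardLaw μ x * h (x i) =
      ∏ j, ((ENNReal.ofReal (if x j = true then (μ j : ℝ) else 1 - (μ j : ℝ))) *
        if j = i then h (x j) else 1) := by
    intro x
    rw [Finset.prod_mul_distrib, Finset.prod_ite_eq' Finset.univ i]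
    simp [rewardLaw, PMF.ofFintype_apply]
  rw [expect, tsum_fintype]
  simp only [h1]
  rw [← Fintype.prod_sum (fun (j : Fin n) (b : Bool) =>
    (ENNReal.ofReal (if b = true then (μ j : ℝ) else 1 - (μ j : ℝ))) * if j = i then h b else 1)]
  rw [Finset.prod_eq_single i]
  · simp [add_comm]
  · intro j _ hj
    simp [hj, add_comm (ENNReal.ofReal (μ j : ℝ)), ofReal_sub_add_ofReal]
  · simp

/-- A reward of 0 leaves the entry of the arm unchanged, so the entry has to be 0 beforehand. -/
lemma expect_playAndRecord_of_mem {S S' : Finset (Fin n)} {r : (Fin n → ℕ) × ℕ} {i : Fin n}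
    (hi : i ∈ S) (hr : r.1 i = 0) (f : ℕ → ℝ≥0∞) :
    expect (playAndRecord μ S S' r) (fun y => f (y.1 i)) = bernoulliExpect (μ i) f := by
  rw [playAndRecord, expect_map]
  have := expect_rewardLaw μ i fun b => f (if b = true then 1 else 0)
  simpa [semiBanditFeedback, hi, hr, bernoulliExpect] using this

lemma playAndRecord_support {S S' : Finset (Fin n)} {r y : (Fin n → ℕ) × ℕ}
    (hy : y ∈ (playAndRecord μ S S' r).support) :
    y.2 = r.2 + 1 ∧ ∀ i ∉ S, y.1 i = r.1 i := by
  rw [playAndRecord, PMF.mem_support_map_iff] at hy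
  obtain ⟨x, -, rfl⟩ := hy
  exact ⟨rfl, fun i hi => by simp [hi]⟩

lemma foldlM_support {p : ℕ} (S : Fin p → Finset (Fin n)) (S' : Finset (Fin n)) (l : List (Fin p)) :
    ∀ (r : (Fin n → ℕ) × ℕ),
      ∀ y ∈ (l.foldlM (fun r q => playAndRecord μ (S q) S' r) r : PMF _).support,
      y.2 = r.2 + l.length ∧ ∀ i, (∀ q ∈ l, i ∉ S q) → y.1 i = r.1 i := by
  induction l with
  | nil =>
    intro r y hy
    simp only [List.foldlM_nil, pmf_pure_eq_pure, PMF.support_pure,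
      Set.mem_singleton_iff] at hy
    subst hy; simp
  | cons q l ih =>
    intro r y hy
    simp only [List.foldlM_cons, pmf_bind_eq_bind, PMF.mem_support_bind_iff] at hy
    obtain ⟨z, hz, hy⟩ := hy
    obtain ⟨h1, h2⟩ := ih z y hy
    obtain ⟨h3, h4⟩ := playAndRecord_support μ hz
    refine ⟨by rw [h1, h3, List.length_cons]; ring, fun i hi => ?_⟩
    rw [h2 i fun q' hq' => hi q' (List.mem_cons_of_mem _ hq'), h4 i (hi q List.mem_cons_self)]

/-- By disjointness the arm is recorded by one query only: its entry stays 0 before that query and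
is untouched afterwards. -/
lemma expect_foldlM {p : ℕ} {S : Fin p → Finset (Fin n)} (S' : Finset (Fin n)) {i : Fin n}
    (hS : ∀ q q', q ≠ q' → Disjoint (S q) (S q')) (f : ℕ → ℝ≥0∞) (l : List (Fin p)) (hl : l.Nodup) :
    ∀ (r : (Fin n → ℕ) × ℕ), r.1 i = 0 → (∃ q ∈ l, i ∈ S q) →
      expect (l.foldlM (fun r q => playAndRecord μ (S q) S' r) r : PMF _) (fun y => f (y.1 i)) =
        bernoulliExpect (μ i) f := by
  induction l with
  | nil => rintro r - ⟨q, hq, -⟩; simp at hq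
  | cons q l ih =>
    intro r hr hex
    rw [List.nodup_cons] at hl
    simp only [List.foldlM_cons, pmf_bind_eq_bind, expect_bind]
    by_cases hq : i ∈ S q
    · rw [← expect_playAndRecord_of_mem μ (S' := S') hq hr f]
      refine expect_congr_support fun y _ => ?_
      have hnot : ∀ q' ∈ l, i ∉ S q' := fun q' hq' hi =>
        Finset.disjoint_left.1 (hS q q' (by rintro rfl; exact hl.1 hq')) hq hi
      rw [expect_congr_support (g := fun _ => f (y.1 i)), expect_const]
      intro z hz
      rw [(foldlM_support μ S S' l y z hz).2 i hnot]
    · obtain ⟨q', hq', hi⟩ := hex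
      have hq'l : q' ∈ l := by
        rcases List.mem_cons.1 hq' with rfl | h
        · exact absurd hi hq
        · exact h
      rw [expect_congr_support (g := fun _ => bernoulliExpect (μ i) f), expect_const]
      intro y hy
      exact ih hl.2 y (by rw [(playAndRecord_support μ hy).2 i hq, hr]) ⟨q', hq'l, hi⟩

lemma unifPartition_support {U : Finset (Fin n)} {p m : ℕ} {S : Fin p → Finset (Fin n)}
    (hS : S ∈ (unifPartition U p m).support) : ∀ q r, q ≠ r → Disjoint (S q) (S r) := by
  classical
  rw [unifPartition] at hS
  split_ifs at hS with h
  · rw [PMF.mem_support_uniformOfFinset_iff, disjointFamilies, Finset.mem_filter] at hS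
    exact hS.2.2
  · rw [PMF.support_pure, Set.mem_singleton_iff] at hS
    subst hS
    simp

variable {exactPulls : Bool} {k k₁ : ℕ} {U A R : Finset (Fin n)}

/-- Every arm of `U` is recorded exactly once by UniformPlay. -/
lemma expect_uniformPlay {i : Fin n} (hi : i ∈ U) (f : ℕ → ℝ≥0∞) :
    expect (uniformPlay μ exactPulls k k₁ U A R) (fun y => f (y.1 i)) =
      bernoulliExpect (μ i) f := by
  classical
  simp only [uniformPlay, pmf_bind_eq_bind, pmf_pure_eq_pure, expect_bind]
  rw [expect_congr_support (g := fun _ => bernoulliExpect (μ i) f), expect_const]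
  intro S hS
  rw [expect_congr_support (g := fun _ => bernoulliExpect (μ i) f), expect_const]
  intro S' _
  -- Either the arm is recorded in the fold and the remainder query leaves it alone, or it lies in
  -- the remainder and its entry is still 0 there.
  by_cases hmem : ∃ q, i ∈ S q
  · rw [← expect_foldlM μ S' (unifPartition_support hS) f (List.finRange (U.card / k₁))
      (List.nodup_finRange _) ((fun _ => 0), 0) rfl (by simpa using hmem)]
    refine expect_congr_support fun r _ => ?_
    split_ifs with h0
    · rw [expect_bind, expect_congr_support (g := fun _ => f (r.1 i)), expect_const]
      intro S₀' _
      rw [expect_congr_support (g := fun _ => f (r.1 i)), expect_const]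
      intro y hy
      rw [(playAndRecord_support μ hy).2 i (by simpa using fun _ => hmem)]
    · rw [expect_pure]
  · have hi0 : i ∈ U \ Finset.univ.biUnion S := by
      simp only [Finset.mem_sdiff, hi, Finset.mem_biUnion, Finset.mem_univ, true_and]
      exact hmem
    rw [expect_congr_support (g := fun _ => bernoulliExpect (μ i) f), expect_const]
    intro r hr
    rw [if_pos (Finset.card_pos.2 ⟨i, by convert hi0⟩), expect_bind,
      expect_congr_support (g := fun _ => bernoulliExpect (μ i) f), expect_const]
    intro S₀' _
    refine expect_playAndRecord_of_mem μ (by convert hi0) ?_ f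
    rw [(foldlM_support μ S S' _ _ r hr).2 i fun q _ hq => hmem ⟨q, hq⟩]

lemma uniformPlay_support {y : (Fin n → ℕ) × ℕ}
    (hy : y ∈ (uniformPlay μ exactPulls k k₁ U A R).support) : y.2 ≤ U.card / k₁ + 1 := by
  simp only [uniformPlay, pmf_bind_eq_bind, pmf_pure_eq_pure,
    PMF.mem_support_bind_iff] at hy
  obtain ⟨S, -, S', -, r, hr, hy⟩ := hy
  have h := (foldlM_support μ S S' _ _ r hr).1
  simp only [List.length_finRange, zero_add] at h
  split_ifs at hy with h0
  · rw [PMF.mem_support_bind_iff] at hy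
    obtain ⟨S₀', -, hy⟩ := hy
    rw [(playAndRecord_support μ hy).1, h]
  · rw [PMF.support_pure, Set.mem_singleton_iff] at hy
    rw [hy, h]; omega

lemma repeatedPlay_support (T : ℕ) : ∀ y ∈ (repeatedPlay μ exactPulls k k₁ U A R T).support,
    y.2 ≤ T * (U.card / k₁ + 1) := by
  induction T with
  | zero =>
    intro y hy
    rw [repeatedPlay, PMF.support_pure, Set.mem_singleton_iff] at hy
    simp [hy]
  | succ T ih =>
    intro y hy
    simp only [repeatedPlay, pmf_bind_eq_bind, pmf_pure_eq_pure,
      PMF.mem_support_bind_iff, PMF.support_pure, Set.mem_singleton_iff] at hy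
    obtain ⟨r, hr, z, hz, rfl⟩ := hy
    have h1 := ih r hr
    have h2 := uniformPlay_support μ hz
    simp only [add_mul, one_mul] at h1 ⊢
    omega

lemma repeatedPlay_recorded_le (T : ℕ) {i : Fin n} (hi : i ∈ U) :
    ∀ y ∈ (repeatedPlay μ exactPulls k k₁ U A R T).support, y.1 i ≤ T := by
  have hplay : ∀ y ∈ (uniformPlay μ exactPulls k k₁ U A R).support, y.1 i ≤ 1 := by
    intro y hy
    by_contra hlt
    -- Testing the Bernoulli law against the indicator of values above 1 gives expectation 0, so no
    -- outcome in the support has such a value.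
    have h := expect_uniformPlay μ (exactPulls := exactPulls) (k := k) (k₁ := k₁) (A := A) (R := R)
      hi (fun m => if m ≤ 1 then 0 else 1)
    simp only [bernoulliExpect, expect] at h
    simp only [zero_le, le_refl, if_true, mul_zero, add_zero, ENNReal.tsum_eq_zero] at h
    have := h y
    rw [if_neg hlt, mul_one] at this
    exact hy this
  induction T with
  | zero =>
    intro y hy
    rw [repeatedPlay, PMF.support_pure, Set.mem_singleton_iff] at hy
    simp [hy]
  | succ T ih =>
    intro y hy
    simp only [repeatedPlay, pmf_bind_eq_bind, pmf_pure_eq_pure,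
      PMF.mem_support_bind_iff, PMF.support_pure, Set.mem_singleton_iff] at hy
    obtain ⟨r, hr, z, hz, rfl⟩ := hy
    exact Nat.add_le_add (ih r hr) (hplay z hz)

/-- The moment generating function of the sum of the recorded rewards of an arm. -/
lemma expect_repeatedPlay {i : Fin n} (hi : i ∈ U) {f : ℕ → ℝ≥0∞} (h0 : f 0 = 1)
    (hadd : ∀ a b, f (a + b) = f a * f b) (T : ℕ) :
    expect (repeatedPlay μ exactPulls k k₁ U A R T) (fun y => f (y.1 i)) =
      bernoulliExpect (μ i) f ^ T := by
  induction T with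
  | zero => simp [repeatedPlay, h0]
  | succ T ih =>
    simp only [repeatedPlay, pmf_bind_eq_bind, pmf_pure_eq_pure, expect_bind,
      expect_pure, hadd, expect_const_mul, expect_mul_const]
    rw [ih, expect_uniformPlay μ hi, pow_succ]

end law

/-! ### The `l`-th largest value and the update of the state -/

/-- In a decreasing list the entries satisfying an upward closed property form an initial segment.
-/
lemma getD_iff_lt_countP (p : ℝ → Prop) [DecidablePred p] (hp : ∀ x y, x ≤ y → p x → p y) :
    ∀ (L : List ℝ), L.Pairwise (· ≥ ·) → ∀ i < L.length, p (L.getD i 0) ↔ i < L.countP p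
  | [], _, i, hi => absurd hi (Nat.not_lt_zero i)
  | a :: L, hL, 0, _ => by
    rw [List.pairwise_cons] at hL
    rw [List.getD_cons_zero, List.countP_pos_iff]
    constructor
    · intro h; exact ⟨a, List.mem_cons_self, by simpa using h⟩
    · rintro ⟨x, hx, hpx⟩
      rcases List.mem_cons.1 hx with rfl | hx
      · simpa using hpx
      · exact hp x a (hL.1 x hx) (by simpa using hpx)
  | a :: L, hL, i + 1, hi => by
    rw [List.pairwise_cons] at hL
    have hi' : i < L.length := by simpa using hi
    have ih := getD_iff_lt_countP p hp L hL.2 i hi'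
    rw [List.getD_cons_succ, ih, List.countP_cons]
    by_cases ha : p a
    · simp [ha]
    · have : L.countP p = 0 := by
        rw [List.countP_eq_zero]
        intro x hx hpx
        exact ha (hp x a (hL.1 x hx) (by simpa using hpx))
      simp [this, ha]

/-- Turns comparisons with an order statistic into counting; a general `p` covers strict and
non-strict comparisons alike. -/
lemma lthLargest_iff {n : ℕ} (p : ℝ → Prop) [DecidablePred p] (hp : ∀ x y, x ≤ y → p x → p y)
    {U : Finset (Fin n)} {f : Fin n → ℝ} {l : ℕ} (hl : 1 ≤ l) (hlU : l ≤ U.card) :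
    p (lthLargest U f l) ↔ l ≤ (U.filter fun i => p (f i)).card := by
  have h := getD_iff_lt_countP p hp ((U.val.map f).sort (· ≥ ·))
    (Multiset.pairwise_sort (U.val.map f) (· ≥ ·)) (l - 1) (by
      rw [Multiset.length_sort, Multiset.card_map]; exact lt_of_lt_of_le (by omega) hlU)
  have hc : ((U.val.map f).sort (· ≥ ·)).countP p = (U.filter fun i => p (f i)).card := by
    rw [← Multiset.coe_countP, Multiset.sort_eq, Multiset.countP_map, Finset.card, Finset.filter_val]
  rw [hc] at h
  rw [lthLargest, h]
  omega

section update
variable {n k : ℕ} {μ : Fin n → unitInterval} {K : Finset (Fin n)} {s : State n}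

/-- The states that are consistent with the set `K` of the top arms. -/
structure Consistent (K : Finset (Fin n)) (s : State n) : Prop where
  accepted : s.A ⊆ K
  rejected : Disjoint s.R K
  undecided : s.U = Finset.univ \ (s.A ∪ s.R)

lemma Consistent.mem_undecided (hs : Consistent K s) (i : Fin n) :
    i ∈ s.U ↔ i ∉ s.A ∧ i ∉ s.R := by
  rw [hs.undecided]; simp

/-- No top arm has been rejected, so the undecided ones are `K \ A`. Hence `k_t` in the elimination
rules is the number of top arms still to be found. -/
lemma Consistent.card_inter (hK : IsTop μ k K) (hs : Consistent K s) :
    (s.U ∩ K).card = k - s.A.card := by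
  have h : s.U ∩ K = K \ s.A := by
    ext i
    rw [Finset.mem_inter, hs.mem_undecided, Finset.mem_sdiff]
    have : i ∈ K → i ∉ s.R := fun hi hR => Finset.disjoint_left.1 hs.rejected hR hi
    tauto
  rw [h, Finset.card_sdiff_of_subset hs.accepted, hK.1]

/-- The rejected arms lie in the complement of `K`, which has `n - k` elements. The special
acceptance rule thus applies exactly when only top arms are undecided. -/
lemma Consistent.card_rejected_iff (hK : IsTop μ k K) (hs : Consistent K s) :
    s.R.card = n - k ↔ s.U ⊆ K := by
  have hsub : s.R ⊆ Kᶜ := fun i hi =>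
    Finset.mem_compl.2 (Finset.disjoint_left.1 hs.rejected hi)
  have hc : Kᶜ.card = n - k := by rw [Finset.card_compl, hK.1, Fintype.card_fin]
  rw [← hc]
  constructor
  · intro h i hi
    by_contra hiK
    have := Finset.eq_of_subset_of_card_le hsub h.ge
    rw [hs.mem_undecided, this, Finset.mem_compl] at hi
    tauto
  · intro h
    congr 1
    refine hsub.antisymm fun i hi => ?_
    by_contra hR
    rw [Finset.mem_compl] at hi
    exact hi (h ((hs.mem_undecided i).2 ⟨fun hA => hi (hs.accepted hA), hR⟩))

variable {δ : ℝ} {t q : ℕ} {m : Fin n → ℝ}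

/-- An undecided arm of `K` whose confidence interval covers its mean is not rejected. -/
lemma not_upper_lt (hK : IsTop μ k K) (hs : Consistent K s) (hA : s.A.card < k)
    (hm : ∀ i ∈ s.U, |m i - μ i| ≤ confWidth n δ t (m i)) {i : Fin n} (hi : i ∈ s.U) (hiK : i ∈ K) :
    ¬ m i + confWidth n δ t (m i) <
      lthLargest s.U (fun j => m j - confWidth n δ t (m j)) (k - s.A.card) := by
  have hcard := hs.card_inter hK
  rw [lthLargest_iff (fun x => m i + confWidth n δ t (m i) < x) (fun x y h1 h2 => h2.trans_le h1)
    (by omega) (hcard ▸ Finset.card_le_card Finset.inter_subset_left), not_le, ← hcard]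
  -- Any arm whose lower bound exceeds the upper bound of `i` has a larger mean, so it belongs to
  -- `K` and differs from `i`: there are fewer than `k_t` of them.
  refine Finset.card_lt_card ⟨fun j hj => ?_, fun h => ?_⟩
  · rw [Finset.mem_filter] at hj
    refine Finset.mem_inter.2 ⟨hj.1, ?_⟩
    by_contra hjK
    have h1 := abs_le.1 (hm j hj.1)
    have h2 := abs_le.1 (hm i hi)
    linarith [hK.2 i hiK j hjK, hj.2]
  · have := (Finset.mem_filter.1 (h (Finset.mem_inter.2 ⟨hi, hiK⟩))).2
    have h2 := abs_le.1 (hm i hi)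
    linarith

/-- An undecided arm outside of `K` whose confidence interval covers its mean is not accepted. -/
lemma not_lt_lower (hK : IsTop μ k K) (hs : Consistent K s)
    (hm : ∀ i ∈ s.U, |m i - μ i| ≤ confWidth n δ t (m i)) {i : Fin n} (hi : i ∈ s.U) (hiK : i ∉ K) :
    ¬ m i - confWidth n δ t (m i) >
      lthLargest s.U (fun j => m j + confWidth n δ t (m j)) (k - s.A.card + 1) := by
  have hcard := hs.card_inter hK
  -- These `k_t + 1` arms all have means at least `μ i`, hence upper bounds at least the lower bound
  -- of `i`.
  have hins : (insert i (s.U ∩ K)).card = k - s.A.card + 1 := by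
    rw [Finset.card_insert_of_notMem (by simp [hiK]), hcard]
  have hsub : insert i (s.U ∩ K) ⊆ s.U :=
    Finset.insert_subset hi Finset.inter_subset_left
  rw [gt_iff_lt, not_lt, lthLargest_iff (fun x => m i - confWidth n δ t (m i) ≤ x)
    (fun x y h1 h2 => h2.trans h1) (by omega) (hins ▸ Finset.card_le_card hsub), ← hins]
  refine Finset.card_le_card fun j hj => Finset.mem_filter.2 ⟨hsub hj, ?_⟩
  have h1 := abs_le.1 (hm j (hsub hj))
  have h2 := abs_le.1 (hm i hi)
  rcases Finset.mem_insert.1 hj with rfl | hj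
  · linarith
  · linarith [hK.2 j (Finset.mem_inter.1 hj).2 i hiK]

lemma Consistent.updateState (hK : IsTop μ k K) (hs : Consistent K s) (hA : s.A.card < k)
    (hm : ∀ i ∈ s.U, |m i - μ i| ≤ confWidth n δ t (m i)) :
    Consistent K (updateState k δ t s m q) := by
  constructor
  · have h1 : s.A ∪ (s.U.filter fun i => m i - confWidth n δ t (m i) >
        lthLargest s.U (fun j => m j + confWidth n δ t (m j)) (k - s.A.card + 1)) ⊆ K := by
      refine Finset.union_subset hs.accepted fun i hi => ?_
      rw [Finset.mem_filter] at hi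
      by_contra hiK
      exact not_lt_lower hK hs hm hi.1 hiK hi.2
    simp only [BestOfK.updateState]
    split_ifs with h
    · exact Finset.union_subset h1 ((hs.card_rejected_iff hK).1 h)
    · exact h1
  · simp only [BestOfK.updateState]
    rw [Finset.disjoint_union_left]
    refine ⟨hs.rejected, Finset.disjoint_left.2 fun i hi hiK => ?_⟩
    rw [Finset.mem_filter] at hi
    exact not_upper_lt hK hs hA hm hi.1 hiK hi.2
  · simp only [BestOfK.updateState]
    ext i
    simp only [Finset.mem_sdiff, Finset.mem_union, Finset.mem_univ, true_and, hs.mem_undecided]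
    split_ifs <;> simp only [Finset.mem_union] <;> tauto

/-- An arm that is well separated from all undecided arms on the other side is decided. -/
lemma notMem_updateState_U (hK : IsTop μ k K) (hs : Consistent K s) (hA : s.A.card < k)
    (hm : ∀ i ∈ s.U, |m i - μ i| ≤ confWidth n δ t (m i)) {i : Fin n}
    (hsep : ∀ j ∈ s.U, (j ∈ K ↔ i ∉ K) →
      2 * confWidth n δ t (m i) + 2 * confWidth n δ t (m j) < |(μ i : ℝ) - μ j|) :
    i ∉ (updateState k δ t s m q).U := by
  have hcard := hs.card_inter hK
  intro hi
  have hiU : i ∈ s.U := by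
    simp only [BestOfK.updateState, Finset.mem_sdiff] at hi; exact hi.1
  simp only [BestOfK.updateState, Finset.mem_sdiff, Finset.mem_union, not_or] at hi
  obtain ⟨-, hacc, -, hrej⟩ := hi
  have h2 := abs_le.1 (hm i hiU)
  by_cases hiK : i ∈ K
  · split_ifs at hacc with hR
    · simp [hiU] at hacc
    -- The undecided arm `j` outside `K` is needed only to ensure `k_t + 1 ≤ |U|`, so that the order
    -- statistic is not the default value.
    · rw [hs.card_rejected_iff hK, Finset.not_subset] at hR
      obtain ⟨j, hjU, hjK⟩ := hR
      apply hacc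
      refine Finset.mem_union_right _ (Finset.mem_filter.2 ⟨hiU, ?_⟩)
      have hins : (insert j (s.U ∩ K)).card = k - s.A.card + 1 := by
        rw [Finset.card_insert_of_notMem (by simp [hjK]), hcard]
      have hsub : insert j (s.U ∩ K) ⊆ s.U :=
        Finset.insert_subset hjU Finset.inter_subset_left
      rw [gt_iff_lt, ← not_le, lthLargest_iff (fun x => m i - confWidth n δ t (m i) ≤ x)
        (fun x y h1 h2 => h2.trans h1) (by omega) (hins ▸ Finset.card_le_card hsub), not_le,
        Nat.lt_succ_iff, ← hcard]
      refine Finset.card_le_card fun l hl => ?_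
      rw [Finset.mem_filter] at hl
      refine Finset.mem_inter.2 ⟨hl.1, ?_⟩
      by_contra hlK
      have h1 := abs_le.1 (hm l hl.1)
      have h3 := hsep l hl.1 (by tauto)
      rw [abs_of_pos (by linarith [hK.2 i hiK l hlK])] at h3
      linarith [hl.2]
  · apply hrej
    refine Finset.mem_filter.2 ⟨hiU, ?_⟩
    rw [lthLargest_iff (fun x => m i + confWidth n δ t (m i) < x)
      (fun x y h1 h2 => h2.trans_le h1) (by omega)
      (hcard ▸ Finset.card_le_card Finset.inter_subset_left), ← hcard]
    refine Finset.card_le_card fun j hj => ?_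
    obtain ⟨hjU, hjK⟩ := Finset.mem_inter.1 hj
    refine Finset.mem_filter.2 ⟨hjU, ?_⟩
    have h1 := abs_le.1 (hm j hjU)
    have h3 := hsep j hjU (by tauto)
    rw [abs_of_neg (by linarith [hK.2 j hjK i hiK])] at h3
    linarith

end update

/-! ### Gaps and complexities -/

section gap
variable {n k : ℕ} {μ : Fin n → unitInterval} {K : Finset (Fin n)} {i : Fin n}

lemma gap_pos (hK : IsTop μ k K) (hk : 1 ≤ k) (hkn : k < n) : 0 < gap μ K i := by
  rw [gap]
  split_ifs with hi
  · have : ∃ j, j ∉ K := by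
      by_contra! h
      have := Finset.card_le_card (fun x _ => h x : Finset.univ ⊆ K)
      rw [hK.1, Finset.card_univ, Fintype.card_fin] at this
      omega
    obtain ⟨j, hj⟩ := this
    have : Nonempty {j // j ∉ K} := ⟨⟨j, hj⟩⟩
    obtain ⟨l, hl⟩ := exists_eq_ciSup_of_finite (f := fun j : {j // j ∉ K} => (μ j : ℝ))
    rw [← hl, sub_pos]
    exact hK.2 i hi l l.2
  · obtain ⟨j, hj⟩ : K.Nonempty := Finset.card_pos.1 (by rw [hK.1]; omega)
    have : Nonempty {j // j ∈ K} := ⟨⟨j, hj⟩⟩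
    obtain ⟨l, hl⟩ := exists_eq_ciInf_of_finite (f := fun j : {j // j ∈ K} => (μ j : ℝ))
    rw [← hl, sub_pos]
    exact hK.2 l l.2 i hi

lemma gap_le_abs {j : Fin n} (hij : j ∈ K ↔ i ∉ K) :
    gap μ K i ≤ |(μ i : ℝ) - μ j| := by
  rw [gap]
  split_ifs with hi
  · have hj : j ∉ K := by tauto
    have := le_ciSup (f := fun j : {j // j ∉ K} => (μ j : ℝ)) (Set.finite_range _).bddAbove ⟨j, hj⟩
    simp only [] at this
    exact le_trans (by linarith) (le_abs_self _)
  · have hj : j ∈ K := by tauto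
    have := ciInf_le (f := fun j : {j // j ∈ K} => (μ j : ℝ)) (Set.finite_range _).bddBelow ⟨j, hj⟩
    simp only [] at this
    exact le_trans (by linarith) (neg_le_abs _)

/-- The variance that enters `τ i`. -/
noncomputable def maxVar (μ : Fin n → unitInterval) (K : Finset (Fin n)) (i : Fin n) : ℝ :=
  if i ∈ K then max (armVar μ i) (⨆ j : {j // j ∉ K}, armVar μ j)
  else max (armVar μ i) (⨆ j : {j // j ∈ K}, armVar μ j)

lemma armVar_nonneg : 0 ≤ armVar μ i := mul_nonneg (μ i).2.1 (sub_nonneg.2 (μ i).2.2)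

lemma armVar_le_maxVar : armVar μ i ≤ maxVar μ K i := by
  rw [maxVar]; split_ifs <;> exact le_max_left _ _

lemma armVar_le_maxVar_of_iff {j : Fin n} (hij : j ∈ K ↔ i ∉ K) : armVar μ j ≤ maxVar μ K i := by
  rw [maxVar]
  split_ifs with hi
  · exact le_max_of_le_right (le_ciSup (f := fun j : {j // j ∉ K} => armVar μ j)
      (Set.finite_range _).bddAbove ⟨j, by tauto⟩)
  · exact le_max_of_le_right (le_ciSup (f := fun j : {j // j ∈ K} => armVar μ j)
      (Set.finite_range _).bddAbove ⟨j, by tauto⟩)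

lemma tau_eq : tau μ K i = 56 / gap μ K i + 256 / gap μ K i ^ 2 * maxVar μ K i := rfl

/-- Means lie in `[0, 1]`, so the gap is at most 1. This supplies the lower bound on `τ` required by
the estimates of `bigT`. -/
lemma tau_ge (hK : IsTop μ k K) (hk : 1 ≤ k) (hkn : k < n) : 56 ≤ tau μ K i := by
  have hpos := gap_pos (i := i) hK hk hkn
  have hle : gap μ K i ≤ 1 := by
    obtain ⟨j, hj⟩ : ∃ j, (j ∈ K ↔ i ∉ K) := by
      by_cases hi : i ∈ K
      · by_contra! h
        have := Finset.card_le_card (fun x _ => by have := h x; tauto : Finset.univ ⊆ K)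
        rw [hK.1, Finset.card_univ, Fintype.card_fin] at this
        omega
      · obtain ⟨j, hj⟩ : K.Nonempty := Finset.card_pos.1 (by rw [hK.1]; omega)
        exact ⟨j, by tauto⟩
    refine (gap_le_abs hj).trans (abs_le.2 ⟨?_, ?_⟩)
    · linarith [(μ i).2.1, (μ j).2.2]
    · linarith [(μ i).2.2, (μ j).2.1]
  have h1 : 56 ≤ 56 / gap μ K i := by rw [le_div_iff₀ hpos]; linarith
  have h2 : 0 ≤ maxVar μ K i := armVar_nonneg.trans armVar_le_maxVar
  have h3 : 0 ≤ 256 / gap μ K i ^ 2 * maxVar μ K i := by positivity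
  rw [tau_eq]; linarith

end gap

/-! ### Deviation of the empirical means -/

lemma exp_combination_shift {w₀ w₁ x y z l u v : ℝ}
    (h : w₀ * Real.exp x + w₁ * Real.exp y ≤ Real.exp (z - l)) (hu : u = x + -z) (hv : v = y + -z) :
    w₀ * Real.exp u + w₁ * Real.exp v ≤ Real.exp (-l) := by
  have h1 := mul_le_mul_of_nonneg_right h (Real.exp_nonneg (-z))
  rw [add_mul, mul_assoc, mul_assoc, ← Real.exp_add, ← Real.exp_add, ← Real.exp_add] at h1
  rw [hu, hv]
  refine h1.trans_eq ?_
  congr 1; ring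

section deviation
variable {n : ℕ} (μ : Fin n → unitInterval) {exactPulls : Bool} {k k₁ : ℕ} {U A R : Finset (Fin n)}

open Classical in
/-- Chernoff's bound for the sum of the recorded rewards of an arm. -/
lemma chernoff {i : Fin n} (hi : i ∈ U) {s c l : ℝ}
    (h : (1 - μ i) * Real.exp (-c) + μ i * Real.exp (s + -c) ≤ Real.exp (-l)) (T : ℕ) :
    expect (repeatedPlay μ exactPulls k k₁ U A R T)
      (fun y => if T * c ≤ s * y.1 i then 1 else 0) ≤ ENNReal.ofReal (Real.exp (-(T * l))) := by
  have hp0 := (μ i).2.1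
  have hp1 := (μ i).2.2
  have hb : bernoulliExpect (μ i) (fun a => ENNReal.ofReal (Real.exp (s * a))) =
      ENNReal.ofReal (1 - μ i + μ i * Real.exp s) := by
    rw [bernoulliExpect, ← ENNReal.ofReal_mul (by linarith), ← ENNReal.ofReal_mul hp0,
      ← ENNReal.ofReal_add (mul_nonneg (by linarith) (Real.exp_nonneg _))
        (mul_nonneg hp0 (Real.exp_nonneg _))]
    simp
  have hnn : 0 ≤ 1 - (μ i : ℝ) + μ i * Real.exp s :=
    add_nonneg (by linarith) (mul_nonneg hp0 (Real.exp_nonneg _))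
  calc _ ≤ expect (repeatedPlay μ exactPulls k k₁ U A R T) (fun y =>
        ENNReal.ofReal (Real.exp (-(T * c))) * ENNReal.ofReal (Real.exp (s * y.1 i))) := by
        refine expect_mono fun y => ?_
        split_ifs with hy
        · rw [← ENNReal.ofReal_mul (Real.exp_nonneg _), ← Real.exp_add, ← ENNReal.ofReal_one]
          exact ENNReal.ofReal_le_ofReal (Real.one_le_exp (by linarith))
        · exact zero_le
    _ = ENNReal.ofReal (((1 - μ i + μ i * Real.exp s) * Real.exp (-c)) ^ T) := by
        rw [expect_const_mul, expect_repeatedPlay μ hi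
          (f := fun a => ENNReal.ofReal (Real.exp (s * a))) (by simp), hb,
          ← ENNReal.ofReal_pow hnn, ← ENNReal.ofReal_mul (Real.exp_nonneg _), mul_pow,
          ← Real.exp_nat_mul, mul_comm, mul_neg]
        intro a b
        rw [← ENNReal.ofReal_mul (Real.exp_nonneg _), ← Real.exp_add]
        congr 2; push_cast; ring
    _ ≤ _ := by
        refine ENNReal.ofReal_le_ofReal ?_
        rw [Real.exp_add, ← mul_assoc, ← add_mul] at h
        rw [← mul_neg, Real.exp_nat_mul]
        exact pow_le_pow_left₀ (mul_nonneg hnn (Real.exp_nonneg _)) h T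

open Classical in
/-- Bernstein's inequality for the empirical mean of an arm. -/
lemma bernstein {i : Fin n} (hi : i ∈ U) {l : ℝ} (hl : 0 < l) {T : ℕ} (hT : 0 < T) :
    expect (repeatedPlay μ exactPulls k k₁ U A R T)
      (fun y => if bernsteinRadius (armVar μ i) l < |(y.1 i : ℝ) / T - μ i| then 1 else 0) ≤
        2 * ENNReal.ofReal (Real.exp (-(T * l))) := by
  have hp0 := (μ i).2.1
  have hp1 := (μ i).2.2
  have hT' : (0 : ℝ) < T := by exact_mod_cast hT
  set b := bernsteinRadius (armVar μ i) l with hb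
  obtain ⟨s₁, hs₁, h₁⟩ := exists_bernoulli_mgf_le hp0 hp1 hl
  -- The lower tail is the upper tail of the reflected variable, with mean `1 - μ i` and the same
  -- variance.
  obtain ⟨s₂, hs₂, h₂⟩ := exists_bernoulli_mgf_le (p := 1 - μ i) (by linarith) (by linarith) hl
  have hb2 : bernsteinRadius ((1 - (μ i : ℝ)) * (1 - (1 - μ i))) l = b := by
    rw [hb, armVar]; congr 1; ring
  rw [hb2] at h₂
  change _ ≤ Real.exp (s₁ * b - l) at h₁
  have hup := chernoff μ (exactPulls := exactPulls) (k := k) (k₁ := k₁) (A := A) (R := R) hi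
    (s := s₁) (c := s₁ * (μ i + b)) (l := l) (exp_combination_shift h₁ (by ring) (by ring)) T
  have hlow := chernoff μ (exactPulls := exactPulls) (k := k) (k₁ := k₁) (A := A) (R := R) hi
    (s := -s₂) (c := -s₂ * (μ i - b)) (l := l) (exp_combination_shift (by rw [sub_sub_cancel, add_comm] at h₂; exact h₂)
      (by ring) (by ring)) T
  rw [two_mul]
  refine le_trans ?_ (add_le_add hup hlow)
  rw [← expect_add]
  refine expect_mono fun y => ?_
  split_ifs with h h3 h4 h4 <;> try simp
  exfalso
  have hy : (y.1 i : ℝ) = T * (y.1 i / T) := by field_simp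
  rw [hy] at h3 h4
  rcases lt_abs.1 h with h5 | h5
  · apply h3
    have : s₁ * (μ i + b) ≤ s₁ * (y.1 i / T) := mul_le_mul_of_nonneg_left (by linarith) hs₁
    nlinarith
  · apply h4
    have : s₂ * (y.1 i / T) ≤ s₂ * (μ i - b) := mul_le_mul_of_nonneg_left (by linarith) hs₂
    nlinarith

end deviation

/-! ### The number of queries -/

/-- The number of queries that may have been made after stage `m`. -/
noncomputable def queryBudget {n : ℕ} [NeZero n] (k : ℕ) (δ : ℝ) (t : Fin n → ℝ) (m : ℕ) : ℝ :=
  2 * min (2 ^ (m + 1) - 2) (4 * bigT n δ (t 0)) +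
    1 / k * ∑ i with k ≤ i.val, min (2 ^ (m + 1) - 2) (4 * bigT n δ (t i))

/-- At most `k` arms of `U` can occupy the first `k` positions of the ordering. -/
lemma card_le_add_card_filter {n k : ℕ} (σ : Equiv.Perm (Fin n)) (U : Finset (Fin n)) :
    U.card ≤ k + (Finset.univ.filter fun i : Fin n => k ≤ i.val ∧ σ i ∈ U).card := by
  have h1 : U.card = (Finset.univ.filter fun i : Fin n => σ i ∈ U).card := by
    rw [← Finset.card_map σ.symm.toEmbedding]
    congr 1
    ext i
    simp
  have h2 : (Finset.univ.filter fun i : Fin n => i.val < k).card ≤ k := by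
    calc _ ≤ (Finset.range k).card := Finset.card_le_card_of_injOn (fun i => i.val)
          (fun i hi => by simpa using hi) (fun i _ j _ h => Fin.ext h)
      _ = k := Finset.card_range k
  rw [h1]
  refine le_trans (Finset.card_le_card (t := (Finset.univ.filter fun i : Fin n => i.val < k) ∪
    Finset.univ.filter fun i : Fin n => k ≤ i.val ∧ σ i ∈ U) fun i hi => ?_)
    ((Finset.card_union_le _ _).trans (by omega))
  simp only [Finset.mem_filter, Finset.mem_univ, true_and, Finset.mem_union] at hi ⊢
  rcases lt_or_ge i.val k with h | h <;> tauto

lemma log_arg_gt {n t : ℕ} {δ : ℝ} (hn2 : 2 ≤ n) (hδ : 0 < δ) (hδ1 : δ < 1) (ht : 1 ≤ t) :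
    1 < 8 * n * (t : ℝ) ^ 2 / δ := by
  have hn : (2 : ℝ) ≤ n := by exact_mod_cast hn2
  have ht' : (1 : ℝ) ≤ (t : ℝ) ^ 2 := one_le_pow₀ (by exact_mod_cast ht)
  rw [lt_div_iff₀ hδ]
  nlinarith

/-- Telescoping, from `1 / (m + 1)² ≤ 2 / ((m + 1) (m + 2))`. -/
lemma sum_one_div_sq_le (m : ℕ) :
    ∑ t ∈ Finset.range m, 1 / ((t + 1 : ℕ) : ℝ) ^ 2 ≤ (4 : ℝ) - 2 / ((m : ℝ) + 1) := by
  induction m with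
  | zero => norm_num
  | succ m ih =>
    rw [Finset.sum_range_succ]
    have h : 1 / ((m + 1 : ℕ) : ℝ) ^ 2 ≤ 2 / ((m : ℝ) + 1) - 2 / ((m + 1 : ℕ) + 1) := by
      push_cast
      have hm : (0 : ℝ) ≤ m := m.cast_nonneg
      rw [div_sub_div _ _ (by positivity) (by positivity), div_le_div_iff₀ (by positivity)
        (by positivity)]
      nlinarith [mul_nonneg hm hm, mul_nonneg hm (mul_nonneg hm hm)]
    push_cast at ih h ⊢
    linarith

section budget
variable {n : ℕ} [NeZero n] {k : ℕ} {δ : ℝ} {t : Fin n → ℝ} {m : ℕ}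

lemma queryBudget_le : queryBudget k δ t m ≤ queryBound k δ t := by
  have h : ∑ i with k ≤ i.val, min (2 ^ (m + 1) - 2) (4 * bigT n δ (t i)) ≤
      4 * ∑ i with k ≤ i.val, bigT n δ (t i) := by
    rw [Finset.mul_sum]
    exact Finset.sum_le_sum fun i _ => min_le_right _ _
  have h2 : 1 / (k : ℝ) * ∑ i with k ≤ i.val, min (2 ^ (m + 1) - 2) (4 * bigT n δ (t i)) ≤
      1 / k * (4 * ∑ i with k ≤ i.val, bigT n δ (t i)) := by gcongr
  have h3 : 1 / (k : ℝ) * (4 * ∑ i with k ≤ i.val, bigT n δ (t i)) =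
      4 / k * ∑ i with k ≤ i.val, bigT n δ (t i) := by ring
  have h4 := min_le_right ((2 : ℝ) ^ (m + 1) - 2) (4 * bigT n δ (t 0))
  rw [queryBudget, queryBound]
  linarith

/-- `2 ^ (m + 1) - 2` is the total number of rounds in the stages `1, …, m`. If `2 ^ m < b`, the cap
`4 b` is not reached even after stage `m + 1`. -/
lemma min_add_pow_le {b : ℝ} (h : 2 ^ m < b) :
    min (2 ^ (m + 1) - 2) (4 * b) + 2 ^ (m + 1) ≤ min (2 ^ (m + 1 + 1) - 2) (4 * b) := by
  have h1 := min_le_left ((2 : ℝ) ^ (m + 1) - 2) (4 * b)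
  have h2 : (2 : ℝ) ^ (m + 1 + 1) = 2 * 2 ^ (m + 1) := by ring
  have h3 : (2 : ℝ) ^ (m + 1) = 2 * 2 ^ m := by ring
  refine le_min (by linarith) (by linarith)

/-- A round makes at most `⌊|U| / k₁⌋ + 1 ≤ 2 + N / k` queries, where `N` counts the undecided arms
beyond the first `k` positions. The 2 is charged to the largest complexity and `1 / k` to each of
those `N` arms. -/
lemma queryBudget_add_le {τ : Fin n → ℝ} {σ : Equiv.Perm (Fin n)} {U : Finset (Fin n)} (hk : 1 ≤ k)
    (hU : ∀ i ∈ U, 2 ^ m < bigT n δ (τ i)) (h0 : 2 ^ m < bigT n δ (τ (σ 0))) :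
    queryBudget k δ (fun i => τ (σ i)) m + 2 ^ (m + 1) * ((U.card / min U.card k : ℕ) + 1) ≤
      queryBudget k δ (fun i => τ (σ i)) (m + 1) := by
  have hk' : (0 : ℝ) < k := by exact_mod_cast hk
  set N := (Finset.univ.filter fun i : Fin n => k ≤ i.val ∧ σ i ∈ U).card with hN
  have hdiv : ((U.card / min U.card k : ℕ) : ℝ) + 1 ≤ 2 + 1 / k * N := by
    rcases le_total U.card k with h | h
    · rw [min_eq_left h]
      have h1 : ((U.card / U.card : ℕ) : ℝ) ≤ 1 := by exact_mod_cast Nat.div_le_of_le_mul (by simp)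
      have : 0 ≤ 1 / (k : ℝ) * N := by positivity
      linarith
    · rw [min_eq_right h]
      have h1 : ((U.card / k : ℕ) : ℝ) ≤ U.card / k := Nat.cast_div_le
      have h2 : (U.card : ℝ) ≤ k + N := by exact_mod_cast card_le_add_card_filter σ U
      have h3 : (U.card : ℝ) / k ≤ 1 + 1 / k * N := by
        rw [div_le_iff₀ hk']; field_simp; linarith
      linarith
  have hsum : ∑ i with k ≤ i.val, min (2 ^ (m + 1) - 2) (4 * bigT n δ (τ (σ i))) +
      2 ^ (m + 1) * N ≤
      ∑ i with k ≤ i.val, min (2 ^ (m + 1 + 1) - 2) (4 * bigT n δ (τ (σ i))) := by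
    have h1 : (2 : ℝ) ^ (m + 1) * N =
        ∑ i : Fin n with k ≤ i.val, if σ i ∈ U then (2 : ℝ) ^ (m + 1) else 0 := by
      rw [← Finset.sum_filter, Finset.filter_filter, Finset.sum_const, nsmul_eq_mul, mul_comm]
    rw [h1, ← Finset.sum_add_distrib]
    refine Finset.sum_le_sum fun i _ => ?_
    split_ifs with hi
    · exact min_add_pow_le (hU _ hi)
    · rw [add_zero]
      refine min_le_min_right _ ?_
      have : (2 : ℝ) ^ (m + 1) ≤ 2 ^ (m + 1 + 1) := pow_le_pow_right₀ (by norm_num) (by omega)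
      linarith
  have h1 := min_add_pow_le h0
  have h2 : 1 / (k : ℝ) * (∑ i with k ≤ i.val, min (2 ^ (m + 1) - 2) (4 * bigT n δ (τ (σ i))) +
      2 ^ (m + 1) * N) ≤
      1 / k * ∑ i with k ≤ i.val, min (2 ^ (m + 1 + 1) - 2) (4 * bigT n δ (τ (σ i))) := by gcongr
  have h3 : (2 : ℝ) ^ (m + 1) * ((U.card / min U.card k : ℕ) + 1) ≤
      2 ^ (m + 1) * (2 + 1 / k * N) := by gcongr
  rw [queryBudget, queryBudget]
  linarith

end budget

/-! ### The invariant of Stagewise Elimination -/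

/-- The states that are expected after stage `m`: no mistake has been made, arms that could have
been decided have been decided, and not too many queries have been made. -/
structure Good {n : ℕ} [NeZero n] (μ : Fin n → unitInterval) (K : Finset (Fin n)) (k : ℕ) (δ : ℝ)
    (σ : Equiv.Perm (Fin n)) (m : ℕ) (s : State n) : Prop where
  consistent : Consistent K s
  undecided : s.A.card < k → ∀ i ∈ s.U, 2 ^ m < bigT n δ (tau μ K i)
  queries : (s.queries : ℝ) ≤ queryBudget k δ (fun i => tau μ K (σ i)) m

section invariant
variable {n : ℕ} [NeZero n] {k : ℕ} {μ : Fin n → unitInterval} {K : Finset (Fin n)} {δ : ℝ}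
  {σ : Equiv.Perm (Fin n)} {m : ℕ} {s : State n}

lemma queryBudget_mono {t : Fin n → ℝ} : queryBudget k δ t m ≤ queryBudget k δ t (m + 1) := by
  have h : (2 : ℝ) ^ (m + 1) - 2 ≤ 2 ^ (m + 1 + 1) - 2 :=
    sub_le_sub_right (pow_le_pow_right₀ (by norm_num) (by omega)) _
  unfold queryBudget
  gcongr

/-- A halted run is frozen, possibly with undecided arms left, which is why `Good.undecided` is
conditional on `|A| < k`. -/
lemma Good.succ_of_halted (h : Good μ K k δ σ m s) (hs : Halted k s) : Good μ K k δ σ (m + 1) s :=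
  ⟨h.consistent, fun hA => absurd hs (not_le.2 hA), h.queries.trans queryBudget_mono⟩

/-- If no empirical mean deviates too much, a stage preserves the invariant. -/
lemma Good.updateState (hK : IsTop μ k K) (hk : 1 ≤ k) (hkn : k < n) (hδ : 0 < δ) (hδ1 : δ < 1)
    (hσ : Antitone fun i => tau μ K (σ i)) (hs : Good μ K k δ σ m s) (hA : s.A.card < k)
    {x : Fin n → ℝ} {q : ℕ} (hx0 : ∀ i ∈ s.U, 0 ≤ x i) (hx1 : ∀ i ∈ s.U, x i ≤ 1)
    (hx : ∀ i ∈ s.U, |x i - μ i| ≤ bernsteinRadius (armVar μ i)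
      (Real.log (8 * n * ((m + 1 : ℕ) : ℝ) ^ 2 / δ) / 2 ^ (m + 1)))
    (hq : q ≤ 2 ^ (m + 1) * (s.U.card / min s.U.card k + 1)) :
    Good μ K k δ σ (m + 1) (BestOfK.updateState k δ (m + 1) s x q) := by
  have hL : 0 < Real.log (8 * n * ((m + 1 : ℕ) : ℝ) ^ 2 / δ) :=
    Real.log_pos (log_arg_gt (by omega) hδ hδ1 (by omega))
  have hT : (2 : ℝ) ≤ 2 ^ (m + 1) := by
    calc (2 : ℝ) = 2 ^ 1 := by norm_num
      _ ≤ 2 ^ (m + 1) := pow_le_pow_right₀ (by norm_num) (by omega)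
  -- Bernstein's inequality holds with denominator `T`; weakening it to `T - 1` matches the
  -- parameter in `confWidth_eq`.
  set l := Real.log (8 * n * ((m + 1 : ℕ) : ℝ) ^ 2 / δ) / (2 ^ (m + 1) - 1) with hl
  have hl0 : 0 < l := div_pos hL (by linarith)
  have hxl : ∀ i ∈ s.U, |x i - μ i| ≤ bernsteinRadius (μ i * (1 - μ i)) l := fun i hi =>
    (hx i hi).trans (bernsteinRadius_mono armVar_nonneg (by
      rw [hl]; apply div_le_div_of_nonneg_left hL.le <;> linarith))
  have hcov : ∀ i ∈ s.U, |x i - μ i| ≤ confWidth n δ (m + 1) (x i) := fun i hi => by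
    rw [confWidth_eq (by omega), ← hl]
    exact abs_sub_le_empirical (μ i).2.1 (μ i).2.2 (hx0 i hi) (hx1 i hi) hl0.le (hxl i hi)
  have hwid : ∀ i ∈ s.U, ∀ v, armVar μ i ≤ v →
      confWidth n δ (m + 1) (x i) ≤ √(2 * v * l) + 11 / 3 * l := fun i hi v hv => by
    rw [confWidth_eq (by omega), ← hl]
    refine (empirical_le (μ i).2.1 (μ i).2.2 hl0.le (hxl i hi)).trans ?_
    gcongr
    exact hv
  have hund := hs.undecided hA
  refine ⟨hs.consistent.updateState hK hA hcov, fun _ i hi => ?_, ?_⟩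
  · have hiU : i ∈ s.U := by
      simp only [BestOfK.updateState, Finset.mem_sdiff] at hi; exact hi.1
    by_contra! hbig
    -- Arm `i` and any competitor across `K` have variance at most `maxVar μ K i`, so their two
    -- doubled widths amount to four widths that fit into the gap of `i`.
    have hτ := log_div_mul_le (by omega) hδ hδ1 (tau_ge (i := i) hK hk hkn) hbig
    rw [tau_eq] at hτ
    have hlt := width_lt_gap (armVar_nonneg.trans armVar_le_maxVar)
      (gap_pos (i := i) hK hk hkn) hl0.le hτ
    refine notMem_updateState_U (q := q) hK hs.consistent hA hcov (fun j hj hij => ?_) hi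
    have h1 := hwid i hiU _ (armVar_le_maxVar (K := K))
    have h2 := hwid j hj _ (armVar_le_maxVar_of_iff hij)
    have h3 := gap_le_abs (μ := μ) hij
    linarith
  -- Some top arm is undecided, so the largest complexity also exceeds the threshold and can be
  -- charged.
  · have hne : s.U.Nonempty := by
      rw [← Finset.card_pos]
      have := hs.consistent.card_inter hK
      have := Finset.card_le_card (Finset.inter_subset_left : s.U ∩ K ⊆ s.U)
      omega
    obtain ⟨i, hi⟩ := hne
    have h0 : 2 ^ m < bigT n δ (tau μ K (σ 0)) := by
      refine (hund i hi).trans_le (bigT_mono (by omega) hδ hδ1 (tau_ge hK hk hkn) ?_)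
      simpa using hσ (Fin.zero_le (σ.symm i))
    refine le_trans ?_ (queryBudget_add_le (U := s.U) hk hund h0)
    have hq' : (q : ℝ) ≤ 2 ^ (m + 1) * ((s.U.card / min s.U.card k : ℕ) + 1) := by exact_mod_cast hq
    simp only [BestOfK.updateState, Nat.cast_add]
    linarith [hs.queries]

open Classical in
/-- The probability that a stage violates the invariant. -/
lemma expect_stage_not_good (hK : IsTop μ k K) (hk : 1 ≤ k) (hkn : k < n) (hδ : 0 < δ) (hδ1 : δ < 1)
    (hσ : Antitone fun i => tau μ K (σ i)) (exactPulls : Bool) (hs : Good μ K k δ σ m s)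
    (hA : s.A.card < k) :
    expect (stage μ exactPulls k δ (m + 1) s)
      (fun s' => if Good μ K k δ σ (m + 1) s' then 0 else 1) ≤
        ENNReal.ofReal (δ / 4 * (1 / ((m + 1 : ℕ) : ℝ) ^ 2)) := by
  have harg := log_arg_gt (n := n) (t := m + 1) (by omega) hδ hδ1 (by omega)
  set L := Real.log (8 * n * ((m + 1 : ℕ) : ℝ) ^ 2 / δ) with hL
  have hL0 : 0 < L := Real.log_pos harg
  have hn : (0 : ℝ) < n := by exact_mod_cast (by omega : 0 < n)
  rw [stage, expect_map]
  calc _ ≤ expect (repeatedPlay μ exactPulls k (min s.U.card k) s.U s.A s.R (2 ^ (m + 1)))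
        (fun y => ∑ i ∈ s.U, if bernsteinRadius (armVar μ i) (L / 2 ^ (m + 1)) <
          |(y.1 i : ℝ) / (2 ^ (m + 1) : ℕ) - μ i| then 1 else 0) := by
        refine expect_mono_support fun y hy => ?_
        split_ifs with hgood
        · exact zero_le
        by_cases hex : ∃ i ∈ s.U, bernsteinRadius (armVar μ i) (L / 2 ^ (m + 1)) <
          |(y.1 i : ℝ) / (2 ^ (m + 1) : ℕ) - μ i|
        · obtain ⟨i, hi, hlt⟩ := hex
          refine le_trans ?_ (Finset.single_le_sum (fun _ _ => zero_le) hi)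
          rw [if_pos hlt]
        · push Not at hex
          refine absurd (hs.updateState hK hk hkn hδ hδ1 hσ hA (fun i _ => by positivity)
            (fun i hi => ?_) (fun i hi => ?_) (repeatedPlay_support μ _ y hy)) hgood
          · rw [div_le_one (by positivity)]
            exact_mod_cast repeatedPlay_recorded_le μ _ hi y hy
          · have h := hex i hi
            rwa [Nat.cast_pow, Nat.cast_ofNat] at h
    _ ≤ ∑ i ∈ s.U, 2 * ENNReal.ofReal (Real.exp (-L)) := by
        rw [expect_finset_sum]
        refine Finset.sum_le_sum fun i hi => ?_
        have h := bernstein μ (exactPulls := exactPulls) (k := k) (k₁ := min s.U.card k)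
          (A := s.A) (R := s.R) hi (l := L / 2 ^ (m + 1)) (by positivity)
          (T := 2 ^ (m + 1)) (by positivity)
        have h2 : (((2 ^ (m + 1) : ℕ) : ℝ) * (L / 2 ^ (m + 1))) = L := by push_cast; field_simp
        rwa [h2] at h
    -- The union bound gives `2 n exp (-L) = 2 n δ / (8 n t²) = δ / (4 t²)` with `t = m + 1`.
    _ ≤ n * (2 * ENNReal.ofReal (Real.exp (-L))) := by
        rw [Finset.sum_const, nsmul_eq_mul]
        gcongr
        simpa using Finset.card_le_univ s.U
    _ = _ := by
        rw [Real.exp_neg, hL, Real.exp_log (by linarith), ← ENNReal.ofReal_natCast n,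
          ← ENNReal.ofReal_ofNat 2, ← ENNReal.ofReal_mul (by norm_num), ← ENNReal.ofReal_mul hn.le]
        congr 1
        have : ((m + 1 : ℕ) : ℝ) ≠ 0 := by positivity
        field_simp
        norm_num

open Classical in
-- Conditioning on the state after `m` stages: it was bad already, or it was good and halted and
-- stays good, or the next stage fails.
lemma expect_run_not_good (hK : IsTop μ k K) (hk : 1 ≤ k) (hkn : k < n) (hδ : 0 < δ) (hδ1 : δ < 1)
    (hσ : Antitone fun i => tau μ K (σ i)) (exactPulls : Bool) (m : ℕ) :
    expect (run μ exactPulls k δ m) (fun s => if Good μ K k δ σ m s then 0 else 1) ≤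
      ∑ t ∈ Finset.range m, ENNReal.ofReal (δ / 4 * (1 / ((t + 1 : ℕ) : ℝ) ^ 2)) := by
  induction m with
  | zero =>
    have hpos : ∀ i, (56 : ℝ) ≤ bigT n δ (tau μ K i) := fun i =>
      (tau_ge hK hk hkn).trans (le_bigT (by omega) hδ hδ1 (tau_ge hK hk hkn))
    have h : Good μ K k δ σ 0 { U := Finset.univ, A := ∅, R := ∅, queries := 0 } := by
      refine ⟨⟨by simp, by simp, by simp⟩, fun _ i _ => by linarith [hpos i], ?_⟩
      have hmin : ∀ i, min ((2 : ℝ) ^ (0 + 1) - 2) (4 * bigT n δ (tau μ K i)) = 0 := fun i => by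
        rw [min_eq_left] <;> norm_num; linarith [hpos i]
      rw [queryBudget]
      simp only [hmin]
      simp
    simp [run, h]
  | succ m ih =>
    rw [run, pmf_bind_eq_bind, expect_bind, Finset.sum_range_succ]
    refine le_trans ?_ (add_le_add_left ih _)
    rw [← expect_const (run μ exactPulls k δ m)
      (ENNReal.ofReal (δ / 4 * (1 / ((m + 1 : ℕ) : ℝ) ^ 2))), ← expect_add]
    refine expect_mono fun s => ?_
    by_cases hg : Good μ K k δ σ m s
    · rw [if_pos hg, zero_add]
      split_ifs with hh
      · rw [pmf_pure_eq_pure, expect_pure, if_pos (hg.succ_of_halted hh)]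
        exact zero_le
      · exact expect_stage_not_good hK hk hkn hδ hδ1 hσ exactPulls hg (not_le.1 hh)
    · rw [if_neg hg]
      refine le_trans ?_ le_self_add
      refine (expect_mono (g := fun _ => 1) fun s' => ?_).trans (expect_const _ _).le
      split_ifs <;> simp

/-- When the number of samples is large enough, good states are final. -/
lemma Good.halted (hK : IsTop μ k K) (hk : 1 ≤ k) (hkn : k < n) (hδ : 0 < δ) (hδ1 : δ < 1)
    (hσ : Antitone fun i => tau μ K (σ i)) (hm : bigT n δ (tau μ K (σ 0)) ≤ 2 ^ m)
    (hs : Good μ K k δ σ m s) : Halted k s ∧ s.A = K := by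
  have hh : Halted k s := by
    by_contra hA
    rw [Halted, not_le] at hA
    have hne : s.U.Nonempty := by
      rw [← Finset.card_pos]
      have := hs.consistent.card_inter hK
      have := Finset.card_le_card (Finset.inter_subset_left : s.U ∩ K ⊆ s.U)
      omega
    obtain ⟨i, hi⟩ := hne
    have h1 := hs.undecided hA i hi
    have h2 : bigT n δ (tau μ K i) ≤ bigT n δ (tau μ K (σ 0)) := by
      refine bigT_mono (by omega) hδ hδ1 (tau_ge hK hk hkn) ?_
      simpa using hσ (Fin.zero_le (σ.symm i))
    linarith
  exact ⟨hh, Finset.eq_of_subset_of_card_le hs.consistent.accepted (by rw [hK.1]; exact hh)⟩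

/-- One cut-off `m` with `2 ^ m` above the largest `bigT` suffices: every good state has halted by
then, and the failure probabilities `δ / (4 t²)` sum to at most `δ`. -/
lemma one_sub_le_haltProb (hK : IsTop μ k K) (hk : 1 ≤ k) (hkn : k < n) (hδ : 0 < δ) (hδ1 : δ < 1)
    (hσ : Antitone fun i => tau μ K (σ i)) (exactPulls : Bool) :
    ENNReal.ofReal (1 - δ) ≤ haltProb μ exactPulls k δ
      {s | s.A = K ∧ (s.queries : ℝ) ≤ queryBound k δ (fun i => tau μ K (σ i))} := by
  classical
  obtain ⟨m, hm⟩ := pow_unbounded_of_one_lt (bigT n δ (tau μ K (σ 0))) (one_lt_two (α := ℝ))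
  refine le_trans ?_ (le_iSup _ m)
  have hbad : expect (run μ exactPulls k δ m) (fun s => if Good μ K k δ σ m s then 0 else 1) ≤
      ENNReal.ofReal δ := by
    refine (expect_run_not_good hK hk hkn hδ hδ1 hσ exactPulls m).trans ?_
    rw [← ENNReal.ofReal_sum_of_nonneg fun t _ => by positivity, ← Finset.mul_sum]
    refine ENNReal.ofReal_le_ofReal ?_
    have h1 := sum_one_div_sq_le m
    have h2 : 0 ≤ 2 / ((m : ℝ) + 1) := by positivity
    nlinarith
  rw [ENNReal.ofReal_sub _ hδ.le, ENNReal.ofReal_one, tsub_le_iff_right,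
    toOuterMeasure_eq_expect]
  refine le_trans ?_ (add_le_add_right hbad _)
  rw [← expect_add]
  refine (expect_const (run μ exactPulls k δ m) 1).ge.trans ?_
  refine expect_mono fun s => ?_
  by_cases hg : Good μ K k δ σ m s
  · have h := hg.halted hK hk hkn hδ hδ1 hσ hm.le
    rw [if_pos ⟨h.1, h.2, hg.queries.trans queryBudget_le⟩]
    exact le_self_add
  · rw [if_neg hg]
    exact le_add_self

end invariant

end BestOfK

theorem theorem3 :
    ∃ C : ℝ, ∃ c : ℕ, 0 < C ∧
      ∀ (n k : ℕ) [NeZero n], 1 ≤ k → k < n →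
      ∀ (μ : Fin n → unitInterval) (K : Finset (Fin n)), BestOfK.IsTop μ k K →
      ∀ (δ : ℝ), 0 < δ → δ < 1 →
      ∀ (exactPulls : Bool) (σ : Equiv.Perm (Fin n)),
        Antitone (fun i => BestOfK.tau μ K (σ i)) →
        ENNReal.ofReal (1 - δ) ≤
          BestOfK.haltProb μ exactPulls k δ
            {s | s.A = K ∧
              (s.queries : ℝ) ≤
                BestOfK.queryBound k δ (fun i => BestOfK.tau μ K (σ i))} ∧
        BestOfK.queryBound k δ (fun i => BestOfK.tau μ K (σ i)) ≤
          C * BestOfK.queryRate k δ (fun i => BestOfK.tau μ K (σ i)) *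
            Real.log (BestOfK.queryRate k δ (fun i => BestOfK.tau μ K (σ i))) ^ c := by
  refine ⟨112, 1, by norm_num, fun n k _ hk hkn μ K hK δ hδ hδ1 exactPulls σ hσ => ⟨?_, ?_⟩⟩
  · exact BestOfK.one_sub_le_haltProb hK hk hkn hδ hδ1 hσ exactPulls
  · exact BestOfK.queryBound_le_rate (by omega) hk hδ hδ1 hσ fun i => BestOfK.tau_ge hK hk hkn
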